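/- **Setting.** Base stations (BSs) form a Poisson point process of intensity $\varphi_b>0$ in the plane, users one of intensity $\varphi_u>0$. Each user requests packets at Poisson rate $\lambda>0$ from a library of $C$ packets of size $T>0$ with popularities $f_1\ge f_2\ge\dots\ge f_C\ge 0$, $\sum_i f_i=1$. A proportion $\alpha\in(0,1)$ of the users is cache-enabled, each storing the $M$ most popular packets, $1\le M\le C$; let $\delta=\sum_{i\le M}f_i$ be the hit ratio and assume $\delta<1$. Slots have length $\tau>0$, the bandwidth is $B>0$, the transmission power $P>0$. Put $\bar T=2^{T/(\tau B)}-1$ and $\bar\lambda=(1-\alpha\delta)\lambda$. *Load.* The number $N$ of users in a cell is Poisson with mean $\varphi_u S$ given the cell size $S$, and $S$ has density $\frac{(\varphi_bK)^K}{\Gamma(K)}s^{K-1}e^{-\varphi_bKs}$, $s\ge0$, $K=3.575$. Given $N=n$, the queue of a BS satisfies $q_{k+1}=\max(q_k-1,0)+a_{k+1}$ with i.i.d. Poisson arrivals $a_k$ of mean $\bar\lambda n\tau$. Let $p_t=\mathbb P(\bar\lambda\tau N\ge1)$ (full-load cell) and $p_0=\sum_{n:\,\bar\lambda\tau n<1}\mathbb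 P(N=n)\lim_{k\to\infty}\mathbb P(q_k=0\mid N=n)$ (free-load cell). *Packet loss.* A typical user at the origin is served by its nearest BS $b_0$, at distance $d_{0,0}$. Each BS is, independently of everything else, active with probability $p_t+(1-p_t)(1-p_0)$ and, independently, transmits a packet outside the caching set with probability $\frac{1-\delta}{(1-\delta)+(1-\alpha)\delta}$. The fading powers $|h_{k,0}|^2$ of all BSs, serving one included, are i.i.d. $\exp(1)$, independent of everything else; $d_{k,0}$ is the distance of BS $k$ from the user. With path-loss exponent $\beta$ and noise power $\sigma^2>0$, $$\mathrm{SINR}=\frac{P|h_{0,0}|^2d_{0,0}^{-\beta}}{I+\sigma^2},\qquad I=\sum_k P|h_{k,0}|^2d_{k,0}^{-\beta},$$ where $k$ runs over the active BSs farther away than $b_0$ if the user is cache-untenable (has no cache), and over those of them that transmit a packet outside the caching set if the user is cache-enabled and requests an uncached packet. The packet loss rate, $\mathcal P_{l,u}(\sigma^2)$ respectively $\mathcal P_{l,c}(\sigma^2)$, is $\mathbb P\big(\tau B\log_2(1+\mathrm{SINR})<T\big)$. **Statement.** Let $\beta=4$. Then $$\lim_{\sigma^2\downarrow0}\mathcal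 P_{l,c}(\sigma^2)=\frac1{\Big[(1-p_0+p_0p_t)\,\frac{1-\delta}{1-\alpha\delta}\,\sqrt{\bar T}\arctan\sqrt{\bar T}\Big]^{-1}+1}.$$ This is lower than the loss rate of cache-untenable users: it is strictly smaller than $$\lim_{\sigma^2\downarrow0}\mathcal P_{l,u}(\sigma^2)=\frac1{\Big[(1-p_0+p_0p_t)\sqrt{\bar T}\arctan\sqrt{\bar T}\Big]^{-1}+1},$$ and also $\mathcal P_{l,c}(\sigma^2)<\mathcal P_{l,u}(\sigma^2)$ for every $\sigma^2>0$. -/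

import Mathlib

open MeasureTheory ProbabilityTheory Filter Topology
open scoped ENNReal NNReal

/-! ### Traffic queue of a cell -/

/-- Law of the number `q_k` of requests queued at a base station after the `k`-th slot, when the
numbers of arrivals in the slots are i.i.d. Poisson variables with mean `r`. The queue starts empty
and follows `q_{k+1} = [q_k - 1]⁺ + a_{k+1}`, with `a_{k+1}` independent of `q_k`
(the subtraction of natural numbers is truncated at `0`). -/
noncomputable def queueLaw (r : ℝ≥0) : ℕ → Measure ℕ
  | 0 => Measure.dirac 0
  | k + 1 => (queueLaw r k).bind fun q => (poissonMeasure r).map fun a => (q - 1) + a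

/-- Equilibrium probability that the queue is empty, `lim_k ℙ(q_k = 0)`. The limit exists, see
`tendsto_queueLaw_zero` below. -/
noncomputable def emptyQueueProb (r : ℝ≥0) : ℝ≥0∞ :=
  limUnder atTop fun k => queueLaw r k {0}

lemma lintegral_queueLaw_succ (r : ℝ≥0) (k : ℕ) (g : ℕ → ℝ≥0∞) :
    ∫⁻ q, g q ∂(queueLaw r (k + 1))
      = ∫⁻ q, (∫⁻ a, g ((q - 1) + a) ∂(poissonMeasure r)) ∂(queueLaw r k) := by
  rw [queueLaw, Measure.lintegral_bind (Measurable.of_discrete.aemeasurable)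
    (Measurable.of_discrete.aemeasurable)]
  refine lintegral_congr fun q => ?_
  rw [lintegral_map Measurable.of_discrete Measurable.of_discrete]

lemma lintegral_queueLaw_succ_le (r : ℝ≥0) (k : ℕ) :
    ∀ g : ℕ → ℝ≥0∞, Antitone g →
      ∫⁻ q, g q ∂(queueLaw r (k + 1)) ≤ ∫⁻ q, g q ∂(queueLaw r k) := by
  induction k with
  | zero =>
    intro g hg
    rw [lintegral_queueLaw_succ]
    simp only [queueLaw, lintegral_dirac]
    calc ∫⁻ a, g (0 - 1 + a) ∂(poissonMeasure r)
        ≤ ∫⁻ _, g 0 ∂(poissonMeasure r) := lintegral_mono fun a => hg (Nat.zero_le _)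
      _ = g 0 := by simp
  | succ k ih =>
    intro g hg
    rw [lintegral_queueLaw_succ r (k + 1) g, lintegral_queueLaw_succ r k g]
    exact ih _ fun p q hpq => lintegral_mono fun a => hg (by omega)

/-- The limit defining `emptyQueueProb` exists. -/
theorem tendsto_queueLaw_zero (r : ℝ≥0) :
    Tendsto (fun k => queueLaw r k {0}) atTop (𝓝 (emptyQueueProb r)) := by
  have h : Antitone fun k => queueLaw r k {0} := by
    refine antitone_nat_of_succ_le fun k => ?_
    have := lintegral_queueLaw_succ_le r k (Set.indicator {0} 1) (by
      intro p q hpq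
      by_cases hq : q = 0
      · have hp : p = 0 := by omega
        simp [hp, hq]
      · simp [hq])
    rwa [lintegral_indicator_one (measurableSet_singleton 0),
      lintegral_indicator_one (measurableSet_singleton 0)] at this
  exact tendsto_nhds_limUnder ⟨_, tendsto_atTop_iInf h⟩

/-! ### Parameters of the network -/

/-- The parameters of the cache-enabled network, with the ranges they are meant to have. -/
structure CacheNetwork where
  /-- intensity of the base stations -/
  φb : ℝ
  /-- intensity of the users -/
  φu : ℝ
  /-- request rate of one user, in packets per second -/
  lam : ℝ
  /-- duration of a slot -/
  τ : ℝ
  /-- packet size -/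
  T : ℝ
  /-- bandwidth -/
  B : ℝ
  /-- transmission power -/
  P : ℝ
  /-- proportion of the users that are cache-enabled -/
  α : ℝ
  /-- number of packets in the library -/
  C : ℕ
  /-- number of packets in the cache of a cache-enabled user -/
  M : ℕ
  /-- packet popularity distribution -/
  f : Fin C → ℝ
  φb_pos : 0 < φb
  φu_pos : 0 < φu
  lam_pos : 0 < lam
  τ_pos : 0 < τ
  T_pos : 0 < T
  B_pos : 0 < B
  P_pos : 0 < P
  α_pos : 0 < α
  α_lt_one : α < 1
  one_le_M : 1 ≤ M
  M_le_C : M ≤ C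
  f_nonneg : ∀ i, 0 ≤ f i
  f_antitone : Antitone f
  f_sum : ∑ i, f i = 1

namespace CacheNetwork

variable (net : CacheNetwork)

/-- Cache hit ratio `δ`: total popularity of the `M` most popular packets. -/
noncomputable def hitRatio : ℝ := ∑ i : Fin net.C, if (i : ℕ) < net.M then net.f i else 0

/-- `λ̄ = (1 - α δ) λ`: rate of the requests that one user contributes to its base station. -/
noncomputable def lamBar : ℝ := (1 - net.α * net.hitRatio) * net.lam

/-- The threshold `T̄ = 2 ^ (T / (τ B)) - 1`. -/
noncomputable def Tbar : ℝ := (2 : ℝ) ^ (net.T / (net.τ * net.B)) - 1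

/-- `ℙ(N = n)`, where `N` is the number of users in a cell. Given the cell size `s`, it is Poisson
with mean `φu s`; the cell size has the Gamma density
`(φb K) ^ K / Γ(K) * s ^ (K - 1) * exp (-(φb K s))` with `K = 3.575`. -/
noncomputable def usersProb (n : ℕ) : ℝ≥0∞ :=
  ∫⁻ s, poissonMeasure (net.φu * s).toNNReal {n} ∂(gammaMeasure 3.575 (net.φb * 3.575))

open Classical in
/-- `p_t`: probability that a cell is full-load, i.e. `λ̄ τ N ≥ 1`. -/
noncomputable def pFull : ℝ :=
  (∑' n : ℕ, if 1 ≤ net.lamBar * net.τ * n then net.usersProb n else 0).toReal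

open Classical in
/-- `p_0`: probability that a cell is free-load, i.e. `λ̄ τ N < 1` and its queue, in equilibrium, is
empty; given `N = n`, the number of arrivals in a slot is Poisson with mean `λ̄ n τ`. -/
noncomputable def pFree : ℝ :=
  (∑' n : ℕ, if net.lamBar * net.τ * n < 1 then
    net.usersProb n * emptyQueueProb (net.lamBar * net.τ * n).toNNReal else 0).toReal

/-- Fraction of active base stations: `φ_a = [p_t + (1 - p_t) (1 - p_0)] φ_b`. -/
noncomputable def activeProb : ℝ := net.pFull + (1 - net.pFull) * (1 - net.pFree)

/-- Fraction `P_{a1} / (P_{a1} + P_{a2})` of the transmitted packets that are not in the caching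
set, where `P_{a1}` is proportional to `1 - δ` and `P_{a2}` to `(1 - α) δ`. -/
noncomputable def uncachedProb : ℝ :=
  (1 - net.hitRatio) / ((1 - net.hitRatio) + (1 - net.α) * net.hitRatio)

end CacheNetwork

/-! ### Spatial model -/

/-- The point process `Σ_k δ_{X k}`, evaluated on a set `A`: the number of points in `A`. -/
noncomputable def pointCount {Ω E : Type*} (X : ℕ → Ω → E) (A : Set E) (ω : Ω) : ℝ≥0∞ :=
  ∑' k, A.indicator 1 (X k ω)

/-- `X 0, X 1, …` enumerates a Poisson point process with intensity measure `Λ` (of infinite total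
mass, so that there are infinitely many points): the number of points in a measurable set `A` of
finite intensity is Poisson with mean `Λ A`, and the numbers of points in disjoint sets are
independent. -/
structure IsPoissonPointProcess {Ω E : Type*} [MeasurableSpace Ω] [MeasurableSpace E]
    (X : ℕ → Ω → E) (Λ : Measure E) (μ : Measure Ω) : Prop where
  measurable : ∀ k, Measurable (X k)
  count_law : ∀ A, MeasurableSet A → Λ A < ∞ →
    μ.map (pointCount X A) = (poissonMeasure (Λ A).toNNReal).map (fun n : ℕ => (n : ℝ≥0∞))
  count_indep : ∀ (m : ℕ) (A : Fin m → Set E), (∀ i, MeasurableSet (A i)) →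
    (∀ i, Λ (A i) < ∞) → Pairwise (fun i j => Disjoint (A i) (A j)) →
    iIndepFun (fun i => pointCount X (A i)) μ

/-- The law on `Bool` that gives `true` probability `p`, for `0 ≤ p ≤ 1`. -/
noncomputable def coinLaw (p : ℝ) : Measure Bool :=
  ENNReal.ofReal p • Measure.dirac true + ENNReal.ofReal (1 - p) • Measure.dirac false

/-- The downlink seen by a typical user at the origin in one slot. The base stations form a Poisson
point process of intensity `φb` in the plane. Independently of the positions, the base stations
carry i.i.d. marks with three independent components: the channel fading power `|h|² ∼ exp(1)` to
the typical user, whether the station is active, and whether the packet that it transmits is outside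
the caching set. Thus the active stations, and the active stations that transmit uncached packets,
are independent thinnings of the process. -/
structure DownlinkModel (net : CacheNetwork) {Ω : Type*} [MeasurableSpace Ω] (μ : Measure Ω) where
  /-- positions of the base stations -/
  pos : ℕ → Ω → EuclideanSpace ℝ (Fin 2)
  /-- fading powers `|h_{k,0}|²` -/
  fading : ℕ → Ω → ℝ
  /-- is the station active in this slot? -/
  active : ℕ → Ω → Bool
  /-- is the transmitted packet outside the caching set? -/
  uncached : ℕ → Ω → Bool
  poisson : IsPoissonPointProcess pos (ENNReal.ofReal net.φb • volume) μ
  measurable_fading : ∀ k, Measurable (fading k)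
  measurable_active : ∀ k, Measurable (active k)
  measurable_uncached : ∀ k, Measurable (uncached k)
  mark_law : ∀ k, μ.map (fun ω => (fading k ω, active k ω, uncached k ω)) =
    (expMeasure 1).prod ((coinLaw net.activeProb).prod (coinLaw net.uncachedProb))
  mark_indep : iIndepFun (fun k ω => (fading k ω, active k ω, uncached k ω)) μ
  pos_mark_indep : IndepFun (fun ω k => pos k ω)
    (fun ω k => (fading k ω, active k ω, uncached k ω)) μ

namespace DownlinkModel

variable {net : CacheNetwork} {Ω : Type*} [MeasurableSpace Ω] {μ : Measure Ω}
  (D : DownlinkModel net μ)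

/-- Index of the serving base station: the one nearest to the origin (almost surely unique). -/
noncomputable def serving (ω : Ω) : ℕ := sInf {k | ∀ j, ‖D.pos k ω‖ ≤ ‖D.pos j ω‖}

/-- Power `P |h_k|² d_k ^ (-β)` received from station `k`, with path-loss exponent `β`. -/
noncomputable def received (β : ℝ) (k : ℕ) (ω : Ω) : ℝ≥0∞ :=
  ENNReal.ofReal (net.P * D.fading k ω * ‖D.pos k ω‖ ^ (-β))

open Classical in
/-- Interference `I_u` at a cache-untenable user: all active stations that are farther away than the
serving one interfere. -/
noncomputable def interferenceUntenable (β : ℝ) (ω : Ω) : ℝ≥0∞ :=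
  ∑' k, if ‖D.pos (D.serving ω) ω‖ < ‖D.pos k ω‖ ∧ D.active k ω = true
    then D.received β k ω else 0

open Classical in
/-- Interference `I_c` at a cache-enabled user, who cancels the signals carrying cached packets:
only active stations transmitting uncached packets interfere. -/
noncomputable def interferenceCached (β : ℝ) (ω : Ω) : ℝ≥0∞ :=
  ∑' k, if ‖D.pos (D.serving ω) ω‖ < ‖D.pos k ω‖ ∧ D.active k ω = true ∧ D.uncached k ω = true
    then D.received β k ω else 0

/-- SINR of a cache-untenable user, with noise power `σ2 > 0`. -/
noncomputable def sinrUntenable (β σ2 : ℝ) (ω : Ω) : ℝ≥0∞ :=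
  D.received β (D.serving ω) ω / (D.interferenceUntenable β ω + ENNReal.ofReal σ2)

/-- SINR of a cache-enabled user requesting an uncached packet, with noise power `σ2 > 0`. -/
noncomputable def sinrCached (β σ2 : ℝ) (ω : Ω) : ℝ≥0∞ :=
  D.received β (D.serving ω) ω / (D.interferenceCached β ω + ENNReal.ofReal σ2)

/-- Packet loss rate of a cache-untenable user: the probability of `τ B log₂ (1 + SINR) < T`. -/
noncomputable def lossUntenable (β σ2 : ℝ) : ℝ :=
  μ.real {ω | net.τ * net.B * Real.logb 2 (1 + (D.sinrUntenable β σ2 ω).toReal) < net.T}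

/-- Packet loss rate of a cache-enabled user requesting an uncached packet. -/
noncomputable def lossCached (β σ2 : ℝ) : ℝ :=
  μ.real {ω | net.τ * net.B * Real.logb 2 (1 + (D.sinrCached β σ2 ω).toReal) < net.T}

end DownlinkModel

/-! Success means SINR ≥ T̄. Freeze the positions and divide by P r⁻⁴, with r the distance of the
serving station: success says that the exponential fading of that station exceeds a noise term plus
a sum of independent terms, one per farther station. By the exponential tail, its conditional
probability is exp(-T̄σ²r⁴/P) ∏ (1 - p + p/(1 + T̄(r/d_k)⁴)), where p is the probability that a
station interferes (`measure_add_tsum_le_ofReal`, `lintegral_expNeg_thinned`).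

The numbers πφ_b d_k² form a unit rate Poisson process on the half-line (`map_normSq_volume_eq`).
Its smallest point R is exp(1), and given R the points beyond it are still Poisson. After rescaling
by R, the Laplace functional gives the product the conditional mean exp(-aR), where a = p ∫₁^∞
T̄/(T̄+u²) du = p √T̄ arctan √T̄ (`lintegral_isLeast_expNeg_tsum`,
`lintegral_one_sub_expNeg_attenuation`). Hence the success probability is E[exp(-κR² - aR)] with κ
proportional to σ² (`measure_le_sinr`). As σ² → 0 it tends to 1/(1+a), so the loss tends to a/(1+a)
= 1/(a⁻¹+1).

The two kinds of users differ only in p: it is `activeProb` for one and `activeProb * uncachedProb`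
for the other, with 0 < `uncachedProb` < 1. Since the expectation is strictly decreasing in a, both
strict comparisons follow.

Conditioning on R is done by hand: R is replaced by a grid value just above it, each grid cell is
handled by the Laplace functional, and the mesh tends to 0. Working with `expNeg` on [0, ∞] removes
integrability conditions and lets the value ∞ encode forbidden points. -/

/-! ### The function `x ↦ exp (-x)` on the extended nonnegative reals -/

/-- `exp (-x)` for `x ∈ [0, ∞]`, with value `0` at `∞`. -/
noncomputable def expNeg (x : ℝ≥0∞) : ℝ≥0∞ := EReal.exp (-(x : EReal))

@[simp] lemma expNeg_zero : expNeg 0 = 1 := by simp [expNeg]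

@[simp] lemma expNeg_top : expNeg ∞ = 0 := by simp [expNeg]

lemma expNeg_antitone : Antitone expNeg := fun x y h => by
  unfold expNeg
  exact EReal.exp_monotone (EReal.neg_le_neg_iff.2 (by exact_mod_cast h))

lemma expNeg_strictAnti : StrictAnti expNeg := fun x y h => by
  unfold expNeg
  exact EReal.exp_strictMono (EReal.neg_lt_neg_iff.2 (by exact_mod_cast h))

lemma expNeg_le_one (x : ℝ≥0∞) : expNeg x ≤ 1 := by
  simpa using expNeg_antitone (zero_le (a := x))

lemma expNeg_ne_top (x : ℝ≥0∞) : expNeg x ≠ ∞ := ((expNeg_le_one x).trans_lt ENNReal.one_lt_top).ne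

lemma expNeg_add (x y : ℝ≥0∞) : expNeg (x + y) = expNeg x * expNeg y := by
  unfold expNeg
  rw [← EReal.exp_add, EReal.coe_ennreal_add, EReal.neg_add, sub_eq_add_neg]
  · left; simp
  · right; simp

lemma expNeg_ofReal {x : ℝ} (hx : 0 ≤ x) :
    expNeg (ENNReal.ofReal x) = ENNReal.ofReal (Real.exp (-x)) := by
  unfold expNeg
  rw [EReal.coe_ennreal_ofReal, max_eq_left hx, ← EReal.coe_neg, EReal.exp_coe]

lemma continuous_expNeg : Continuous expNeg := by
  unfold expNeg
  exact ENNReal.continuous_exp.comp (continuous_neg.comp continuous_coe_ennreal_ereal)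

lemma measurable_expNeg : Measurable expNeg := continuous_expNeg.measurable

@[fun_prop]
lemma Measurable.expNeg {α : Type*} [MeasurableSpace α] {f : α → ℝ≥0∞} (hf : Measurable f) :
    Measurable fun x => expNeg (f x) := measurable_expNeg.comp hf

lemma expNeg_sum {ι : Type*} (s : Finset ι) (f : ι → ℝ≥0∞) :
    expNeg (∑ i ∈ s, f i) = ∏ i ∈ s, expNeg (f i) := by
  classical
  induction s using Finset.induction_on with
  | empty => simp
  | insert a s ha ih => rw [Finset.sum_insert ha, Finset.prod_insert ha, expNeg_add, ih]

lemma expNeg_mul_natCast (a : ℝ≥0∞) (n : ℕ) : expNeg (a * n) = expNeg a ^ n := by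
  induction n with
  | zero => simp
  | succ n ih => rw [Nat.cast_succ, mul_add, mul_one, expNeg_add, ih, pow_succ]

/-! ### Poisson distribution -/

lemma lintegral_poissonMeasure (r : ℝ≥0) (f : ℕ → ℝ≥0∞) :
    ∫⁻ n, f n ∂(poissonMeasure r)
      = ∑' n : ℕ, ENNReal.ofReal (Real.exp (-r) * r ^ n / n.factorial) * f n := by
  rw [poissonMeasure, lintegral_sum_measure]
  simp [lintegral_smul_measure]

/-- Probability generating function of the Poisson distribution. -/
lemma lintegral_expNeg_poissonMeasure (r : ℝ≥0) (a : ℝ≥0∞) :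
    ∫⁻ n : ℕ, expNeg (a * n) ∂(poissonMeasure r) = expNeg (r * (1 - expNeg a)) := by
  obtain ⟨z, hz0, hz⟩ : ∃ z : ℝ, 0 ≤ z ∧ expNeg a = ENNReal.ofReal z :=
    ⟨(expNeg a).toReal, ENNReal.toReal_nonneg, (ENNReal.ofReal_toReal (expNeg_ne_top a)).symm⟩
  have hz1 : z ≤ 1 := by
    have := expNeg_le_one a
    rwa [hz, ENNReal.ofReal_le_one] at this
  have hs : HasSum (fun n : ℕ => Real.exp (-r) * r ^ n / n.factorial * z ^ n)
      (Real.exp (-(r * (1 - z)))) := by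
    have h := (NormedSpace.expSeries_div_hasSum_exp ((r : ℝ) * z)).mul_left (Real.exp (-r))
    rw [← Real.exp_eq_exp_ℝ, ← Real.exp_add] at h
    convert! h using 1
    · ext n; rw [mul_pow]; ring
    · congr 1; ring
  rw [lintegral_poissonMeasure]
  have h2 : (r : ℝ≥0∞) * (1 - ENNReal.ofReal z) = ENNReal.ofReal (r * (1 - z)) := by
    rw [ENNReal.ofReal_mul (by positivity), ENNReal.ofReal_sub _ hz0, ENNReal.ofReal_one,
      ENNReal.ofReal_coe_nnreal]
  rw [hz, h2, expNeg_ofReal (mul_nonneg (by positivity) (by linarith)), ← hs.tsum_eq,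
    ENNReal.ofReal_tsum_of_nonneg (fun n => by positivity) hs.summable]
  refine tsum_congr fun n => ?_
  rw [expNeg_mul_natCast, hz, ENNReal.ofReal_mul (by positivity), ENNReal.ofReal_pow hz0]

/-- Mean of the Poisson distribution. -/
lemma lintegral_natCast_poissonMeasure (r : ℝ≥0) :
    ∫⁻ n : ℕ, (n : ℝ≥0∞) ∂(poissonMeasure r) = r := by
  have hs : HasSum (fun n : ℕ => Real.exp (-r) * r ^ n / n.factorial * n) r := by
    rw [← hasSum_nat_add_iff' 1]
    convert! (hasSum_one_poissonMeasure r).mul_left (r : ℝ) using 1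
    · ext n
      rw [Nat.factorial_succ]
      push_cast
      field_simp
      ring
    · simp
  have h2 : (r : ℝ≥0∞) = ENNReal.ofReal
      (∑' n : ℕ, Real.exp (-r) * (r : ℝ) ^ n / n.factorial * n) := by
    rw [hs.tsum_eq, ENNReal.ofReal_coe_nnreal]
  rw [lintegral_poissonMeasure, h2,
    ENNReal.ofReal_tsum_of_nonneg (fun n => by positivity) hs.summable]
  refine tsum_congr fun n => ?_
  rw [ENNReal.ofReal_mul (by positivity), ENNReal.ofReal_natCast]

/-! ### Poisson point processes -/

lemma measurable_pointCount {Ω E : Type*} [MeasurableSpace Ω] [MeasurableSpace E] {X : ℕ → Ω → E}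
    (hX : ∀ k, Measurable (X k)) {A : Set E} (hA : MeasurableSet A) :
    Measurable (pointCount X A) := by
  unfold pointCount
  exact Measurable.tsum fun k =>
    ((measurable_one.indicator hA).comp (hX k) : Measurable fun ω => A.indicator 1 (X k ω))

namespace IsPoissonPointProcess

variable {Ω E : Type*} [MeasurableSpace Ω] [MeasurableSpace E] {X : ℕ → Ω → E} {Λ : Measure E}
  {μ : Measure Ω}

/-- Image of a Poisson point process under a measurable map. -/
lemma map {F : Type*} [MeasurableSpace F] (h : IsPoissonPointProcess X Λ μ) {π : E → F}
    (hπ : Measurable π) : IsPoissonPointProcess (fun k ω => π (X k ω)) (Λ.map π) μ := by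
  have hc : ∀ A : Set F, pointCount (fun k ω => π (X k ω)) A = pointCount X (π ⁻¹' A) :=
    fun A => rfl
  refine ⟨fun k => hπ.comp (h.measurable k), fun A hA hf => ?_, fun m A hA hf hd => ?_⟩
  · rw [Measure.map_apply hπ hA] at hf ⊢
    rw [hc, h.count_law _ (hπ hA) hf]
  · simp_rw [hc]
    refine h.count_indep m _ (fun i => hπ (hA i)) (fun i => ?_) fun i j hij =>
      (hd hij).preimage π
    rw [← Measure.map_apply hπ (hA i)]
    exact hf i

lemma lintegral_comp_pointCount (h : IsPoissonPointProcess X Λ μ) {A : Set E}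
    (hA : MeasurableSet A) (hf : Λ A < ∞) {f : ℝ≥0∞ → ℝ≥0∞} (hfm : Measurable f) :
    ∫⁻ ω, f (pointCount X A ω) ∂μ = ∫⁻ n : ℕ, f n ∂(poissonMeasure (Λ A).toNNReal) := by
  rw [← lintegral_map hfm (measurable_pointCount h.measurable hA), h.count_law A hA hf,
    lintegral_map hfm Measurable.of_discrete]

lemma lintegral_pointCount (h : IsPoissonPointProcess X Λ μ) {A : Set E}
    (hA : MeasurableSet A) (hf : Λ A < ∞) : ∫⁻ ω, pointCount X A ω ∂μ = Λ A := by
  rw [h.lintegral_comp_pointCount hA hf (f := fun x => x) measurable_id, lintegral_natCast_poissonMeasure, ENNReal.coe_toNNReal hf.ne]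

lemma lintegral_expNeg_pointCount (h : IsPoissonPointProcess X Λ μ) {A : Set E}
    (hA : MeasurableSet A) (hf : Λ A < ∞) (a : ℝ≥0∞) :
    ∫⁻ ω, expNeg (a * pointCount X A ω) ∂μ = expNeg (Λ A * (1 - expNeg a)) := by
  rw [h.lintegral_comp_pointCount hA hf (f := fun x => expNeg (a * x)) (by fun_prop),
    lintegral_expNeg_poissonMeasure, ENNReal.coe_toNNReal hf.ne]

/-- The mean measure of the process is its intensity. The Poisson mean gives this on sets of finite
intensity; a general set is cut along disjoint pieces of a σ-finite exhaustion. -/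
lemma sum_map_eq [SigmaFinite Λ] (h : IsPoissonPointProcess X Λ μ) :
    Measure.sum (fun k => μ.map (X k)) = Λ := by
  have key : ∀ A, MeasurableSet A → Λ A < ∞ → Measure.sum (fun k => μ.map (X k)) A = Λ A := by
    intro A hA hf
    rw [Measure.sum_apply _ hA, ← h.lintegral_pointCount hA hf]
    unfold pointCount
    rw [lintegral_tsum (f := fun k ω => A.indicator 1 (X k ω))
      fun k => ((measurable_one.indicator hA).comp (h.measurable k)).aemeasurable]
    refine tsum_congr fun k => ?_
    rw [← lintegral_map (measurable_one.indicator hA) (h.measurable k), lintegral_indicator_one hA]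
  ext A hA
  have hU : A = ⋃ n, A ∩ disjointed (spanningSets Λ) n := by
    rw [← Set.inter_iUnion, iUnion_disjointed, iUnion_spanningSets, Set.inter_univ]
  have hm : ∀ n, MeasurableSet (A ∩ disjointed (spanningSets Λ) n) := fun n =>
    hA.inter (MeasurableSet.disjointed (measurableSet_spanningSets Λ) n)
  have hd : Pairwise (Function.onFun Disjoint fun n => A ∩ disjointed (spanningSets Λ) n) :=
    fun i j hij => (disjoint_disjointed _ hij).mono Set.inter_subset_right Set.inter_subset_right
  rw [hU, measure_iUnion hd hm, measure_iUnion hd hm]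
  refine tsum_congr fun n => key _ (hm n) ?_
  exact (measure_mono (Set.inter_subset_right.trans (disjointed_subset _ n))).trans_lt
    (measure_spanningSets_lt_top Λ n)

/-- Campbell's formula. -/
lemma lintegral_tsum [SigmaFinite Λ] (h : IsPoissonPointProcess X Λ μ) {g : E → ℝ≥0∞}
    (hg : Measurable g) : ∫⁻ ω, ∑' k, g (X k ω) ∂μ = ∫⁻ x, g x ∂Λ := by
  rw [MeasureTheory.lintegral_tsum (f := fun k ω => g (X k ω)) fun k => (hg.comp (h.measurable k)).aemeasurable,
    ← h.sum_map_eq, lintegral_sum_measure]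
  exact tsum_congr fun k => (lintegral_map hg (h.measurable k)).symm

/-- Counts on disjoint sets are independent, so the expectation factors, and each factor is a
Poisson generating function. -/
lemma lintegral_expNeg_sum_pointCount (h : IsPoissonPointProcess X Λ μ) {ι : Type*} [Fintype ι]
    (A : ι → Set E) (hA : ∀ i, MeasurableSet (A i)) (hf : ∀ i, Λ (A i) < ∞)
    (hd : Pairwise fun i j => Disjoint (A i) (A j)) (c : ι → ℝ≥0∞) :
    ∫⁻ ω, expNeg (∑ i, c i * pointCount X (A i) ω) ∂μ
      = expNeg (∑ i, (1 - expNeg (c i)) * Λ (A i)) := by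
  have e := Fintype.equivFin ι
  have hi := h.count_indep _ (fun i => A (e.symm i)) (fun i => hA _) (fun i => hf _)
    fun i j hij => hd (e.symm.injective.ne hij)
  have hi' := hi.comp (fun i x => expNeg (c (e.symm i) * x)) fun i => by fun_prop
  have := lintegral_prod_eq_prod_lintegral_of_indepFun Finset.univ
    (fun i ω => expNeg (c (e.symm i) * pointCount X (A (e.symm i)) ω)) hi' fun i =>
      (measurable_expNeg.comp (measurable_const_mul _)).comp
        (measurable_pointCount h.measurable (hA (e.symm i)))
  simp_rw [expNeg_sum]
  have h1 : ∀ ω, ∏ i, expNeg (c i * pointCount X (A i) ω)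
      = ∏ i, expNeg (c (e.symm i) * pointCount X (A (e.symm i)) ω) := fun ω =>
    (Equiv.prod_comp e.symm fun i => expNeg (c i * pointCount X (A i) ω)).symm
  rw [lintegral_congr h1, this, ← Equiv.prod_comp e.symm]
  refine Finset.prod_congr rfl fun i _ => ?_
  rw [h.lintegral_expNeg_pointCount (hA _) (hf _), mul_comm]

lemma lintegral_expNeg_tsum_indicator_simpleFunc (h : IsPoissonPointProcess X Λ μ)
    (φ : SimpleFunc E ℝ≥0∞) {S : Set E} (hS : MeasurableSet S) (hf : Λ S < ∞) :
    ∫⁻ ω, expNeg (∑' k, S.indicator φ (X k ω)) ∂μ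
      = expNeg (∫⁻ x, (1 - expNeg (S.indicator φ x)) ∂Λ) := by
  classical
  have hA : ∀ a : φ.range, MeasurableSet (φ ⁻¹' {a.1} ∩ S) := fun a =>
    (φ.measurableSet_fiber a.1).inter hS
  -- Any function of `S.indicator φ` that vanishes at 0 is a finite combination of indicators of
  -- level sets. It is used for the identity, which turns the sum over points into counts, and for
  -- `1 - expNeg`, which computes the integral.
  have hrep : ∀ F : ℝ≥0∞ → ℝ≥0∞, F 0 = 0 → ∀ x, F (S.indicator φ x)
      = ∑ a : φ.range, F a.1 * (φ ⁻¹' {a.1} ∩ S).indicator 1 x := by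
    intro F hF x
    by_cases hx : x ∈ S
    · rw [Finset.sum_eq_single ⟨φ x, φ.mem_range_self x⟩]
      · simp [hx]
      · intro b _ hb
        have : φ x ≠ b.1 := fun h => hb (Subtype.ext h.symm)
        simp [this]
      · simp
    · simp [hx, hF]
  have h1 : ∀ ω, ∑' k, S.indicator φ (X k ω)
      = ∑ a : φ.range, a.1 * pointCount X (φ ⁻¹' {a.1} ∩ S) ω := by
    intro ω
    have := hrep (fun y => y) rfl
    simp_rw [this, pointCount, ← ENNReal.tsum_mul_left]
    exact Summable.tsum_finsetSum fun i _ => ENNReal.summable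
  have h2 : ∫⁻ x, (1 - expNeg (S.indicator φ x)) ∂Λ
      = ∑ a : φ.range, (1 - expNeg a.1) * Λ (φ ⁻¹' {a.1} ∩ S) := by
    have := hrep (fun y => 1 - expNeg y) (by simp)
    rw [lintegral_congr this, lintegral_finsetSum _ fun a _ => (measurable_one.indicator (hA a)).const_mul _]
    refine Finset.sum_congr rfl fun a _ => ?_
    rw [lintegral_const_mul _ (measurable_one.indicator (hA a)), lintegral_indicator_one (hA a)]
  simp_rw [h1, h2]
  refine h.lintegral_expNeg_sum_pointCount _ hA
    (fun a => (measure_mono Set.inter_subset_right).trans_lt hf) (fun a b hab => ?_) _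
  refine Set.disjoint_left.2 fun x hx hx' => hab (Subtype.ext ?_)
  exact hx.1.symm.trans hx'.1

/-- Laplace functional of a Poisson point process. -/
theorem lintegral_expNeg_tsum [SigmaFinite Λ] [IsProbabilityMeasure μ]
    (h : IsPoissonPointProcess X Λ μ) {g : E → ℝ≥0∞} (hg : Measurable g) :
    ∫⁻ ω, expNeg (∑' k, g (X k ω)) ∂μ = expNeg (∫⁻ x, (1 - expNeg (g x)) ∂Λ) := by
  -- Simple functions increasing to `g`, cut off to sets of finite intensity because count laws are
  -- given only there.
  set φ : ℕ → E → ℝ≥0∞ := fun n => (spanningSets Λ n).indicator (SimpleFunc.eapprox g n) with hφ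
  have hφm : ∀ n, Measurable (φ n) := fun n =>
    (SimpleFunc.measurable _).indicator (measurableSet_spanningSets Λ n)
  have hmono : ∀ x, Monotone fun n => φ n x := by
    intro x m n hmn
    simp only [hφ]
    by_cases hx : x ∈ spanningSets Λ m
    · rw [Set.indicator_of_mem hx, Set.indicator_of_mem (monotone_spanningSets Λ hmn hx)]
      exact SimpleFunc.monotone_eapprox g hmn x
    · simp [Set.indicator_of_notMem hx]
  have hlim : ∀ x, Tendsto (fun n => φ n x) atTop (𝓝 (g x)) := by
    intro x
    refine (SimpleFunc.tendsto_eapprox hg x).congr' ?_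
    filter_upwards [eventually_ge_atTop (spanningSetsIndex Λ x)] with n hn
    rw [hφ]
    simp only
    rw [Set.indicator_of_mem]
    exact monotone_spanningSets Λ hn (mem_spanningSetsIndex Λ x)
  have hn : ∀ n, ∫⁻ ω, expNeg (∑' k, φ n (X k ω)) ∂μ = expNeg (∫⁻ x, (1 - expNeg (φ n x)) ∂Λ) :=
    fun n => h.lintegral_expNeg_tsum_indicator_simpleFunc _ (measurableSet_spanningSets Λ n)
      (measure_spanningSets_lt_top Λ n)
  have hR : Tendsto (fun n => expNeg (∫⁻ x, (1 - expNeg (φ n x)) ∂Λ)) atTop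
      (𝓝 (expNeg (∫⁻ x, (1 - expNeg (g x)) ∂Λ))) := by
    refine (continuous_expNeg.tendsto _).comp ?_
    refine lintegral_tendsto_of_tendsto_of_monotone (fun n => ?_) ?_ ?_
    · exact ((hφm n).expNeg.const_sub 1).aemeasurable
    · exact ae_of_all _ fun x m n hmn => tsub_le_tsub_left (expNeg_antitone (hmono x hmn)) 1
    · refine ae_of_all _ fun x => ?_
      exact ENNReal.Tendsto.sub tendsto_const_nhds ((continuous_expNeg.tendsto _).comp (hlim x))
        (Or.inl ENNReal.one_ne_top)
  have hL : Tendsto (fun n => ∫⁻ ω, expNeg (∑' k, φ n (X k ω)) ∂μ) atTop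
      (𝓝 (∫⁻ ω, expNeg (∑' k, g (X k ω)) ∂μ)) := by
    refine tendsto_lintegral_of_dominated_convergence (fun _ => 1) (fun n => ?_) (fun n => ?_)
      (by simp) ?_
    · exact (Measurable.tsum fun k => (hφm n).comp (h.measurable k)).expNeg
    · exact ae_of_all _ fun ω => expNeg_le_one _
    · refine ae_of_all _ fun ω => (continuous_expNeg.tendsto _).comp ?_
      -- Monotone convergence of the sum over points, read as an integral for the counting measure.
      have := lintegral_tendsto_of_tendsto_of_monotone (μ := Measure.count)
        (f := fun n (k : ℕ) => φ n (X k ω)) (F := fun k => g (X k ω))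
        (fun n => Measurable.of_discrete.aemeasurable) (ae_of_all _ fun k => hmono _)
        (ae_of_all _ fun k => hlim _)
      simpa only [lintegral_count] using this
  exact tendsto_nhds_unique (hL.congr hn) hR

end IsPoissonPointProcess

/-! ### Exponential distribution -/

lemma expMeasure_Ici {y : ℝ} (hy : 0 ≤ y) :
    expMeasure 1 (Set.Ici y) = expNeg (ENNReal.ofReal y) := by
  have := isProbabilityMeasure_expMeasure one_pos
  have hac : expMeasure 1 ≪ volume := withDensity_absolutelyContinuous _ _
  have h0 : expMeasure 1 {y} = 0 := hac (by simp)
  have h1 : (expMeasure 1).real (Set.Iic y) = 1 - Real.exp (-(1 * y)) := by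
    rw [← cdf_eq_real, cdf_expMeasure_eq one_pos, if_pos hy]
  have h2 : (expMeasure 1).real (Set.Ioi y) = Real.exp (-y) := by
    rw [← Set.compl_Iic, measureReal_compl measurableSet_Iic, h1]
    simp
  rw [expNeg_ofReal hy, ← h2, ofReal_measureReal, ← Set.Ioi_union_left]
  exact le_antisymm ((measure_union_le _ _).trans (by rw [h0, add_zero]))
    (measure_mono Set.subset_union_left)

/-! ### The smallest point of a Poisson process on the half-line -/

namespace IsPoissonPointProcess

variable {Ω : Type*} [MeasurableSpace Ω] {Y : ℕ → Ω → ℝ} {μ : Measure Ω} {R : Ω → ℝ}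

lemma measurableSet_forall_le (hY : ∀ k, Measurable (Y k)) (t : ℝ) :
    MeasurableSet {ω | ∀ k, t ≤ Y k ω} := by
  rw [Set.ofPred_forall]
  exact MeasurableSet.iInter fun k => measurableSet_le measurable_const (hY k)

/-- Giving the value ∞ to points below `t` makes `expNeg` of the sum vanish unless there are no such
points. The restriction to the void event is thus absorbed into the Laplace functional of `g'`, and
the extra mass of (0, t) produces the factor exp(-t). -/
lemma setLIntegral_forall_le_expNeg_tsum [IsProbabilityMeasure μ]
    (h : IsPoissonPointProcess Y (volume.restrict (Set.Ioi 0)) μ) {t : ℝ}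
    {g : ℝ → ℝ≥0∞} (hg : Measurable g) (hgt : ∀ y < t, g y = 0) :
    ∫⁻ ω in {ω | ∀ k, t ≤ Y k ω}, expNeg (∑' k, g (Y k ω)) ∂μ
      = expNeg (ENNReal.ofReal t) * expNeg (∫⁻ y in Set.Ioi 0, (1 - expNeg (g y))) := by
  set g' : ℝ → ℝ≥0∞ := fun y => if y < t then ∞ else g y with hg'
  have hg'm : Measurable g' := Measurable.ite measurableSet_Iio measurable_const hg
  have h1 : ∀ ω, {ω | ∀ k, t ≤ Y k ω}.indicator (fun ω => expNeg (∑' k, g (Y k ω))) ω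
      = expNeg (∑' k, g' (Y k ω)) := by
    intro ω
    by_cases hω : ∀ k, t ≤ Y k ω
    · rw [Set.indicator_of_mem (by exact hω)]
      congr 1
      exact tsum_congr fun k => by simp [hg', hω k]
    · rw [Set.indicator_of_notMem (by exact hω)]
      push Not at hω
      obtain ⟨k, hk⟩ := hω
      rw [ENNReal.tsum_eq_top_of_eq_top ⟨k, by simp [hg', hk]⟩, expNeg_top]
  have h2 : ∀ y, 1 - expNeg (g' y) = (Set.Iio t).indicator 1 y + (1 - expNeg (g y)) := by
    intro y
    by_cases hy : y < t
    · simp [hg', hy, hgt y hy]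
    · simp [hg', hy]
  rw [← lintegral_indicator (measurableSet_forall_le h.measurable t), lintegral_congr h1,
    h.lintegral_expNeg_tsum hg'm, lintegral_congr h2,
    lintegral_add_left (measurable_one.indicator measurableSet_Iio), expNeg_add,
    lintegral_indicator_one measurableSet_Iio, Measure.restrict_apply measurableSet_Iio,
    Set.Iio_inter_Ioi, Real.volume_Ioo, sub_zero]

lemma measure_forall_le [IsProbabilityMeasure μ]
    (h : IsPoissonPointProcess Y (volume.restrict (Set.Ioi 0)) μ) (t : ℝ) :
    μ {ω | ∀ k, t ≤ Y k ω} = expNeg (ENNReal.ofReal t) := by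
  have := h.setLIntegral_forall_le_expNeg_tsum (t := t) (g := fun _ => 0) measurable_const (by simp)
  simpa using this

/-- The event says that the smallest point lies in [t, t'), and it is independent of the points
beyond t'. The proof subtracts the void-event identities at `t` and `t'`, whose second factor is the
same because `g` vanishes up to `t'`. -/
lemma setLIntegral_diff_expNeg_tsum [IsProbabilityMeasure μ]
    (h : IsPoissonPointProcess Y (volume.restrict (Set.Ioi 0)) μ) {t t' : ℝ}
    (htt' : t ≤ t') {g : ℝ → ℝ≥0∞} (hg : Measurable g) (hgt : ∀ y ≤ t', g y = 0) :
    ∫⁻ ω in {ω | ∀ k, t ≤ Y k ω} \ {ω | ∀ k, t' ≤ Y k ω}, expNeg (∑' k, g (Y k ω)) ∂μ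
      = μ ({ω | ∀ k, t ≤ Y k ω} \ {ω | ∀ k, t' ≤ Y k ω})
        * expNeg (∫⁻ y in Set.Ioi 0, (1 - expNeg (g y))) := by
  set V := {ω | ∀ k, t ≤ Y k ω} with hV
  set V' := {ω | ∀ k, t' ≤ Y k ω} with hV'
  have hVV' : V' ⊆ V := fun ω hω k => htt'.trans (hω k)
  have hm' : MeasurableSet V' := measurableSet_forall_le h.measurable t'
  have e1 := lintegral_inter_add_sdiff (μ := μ) (fun ω => expNeg (∑' k, g (Y k ω))) V hm'
  have e2 := measure_inter_add_sdiff (μ := μ) V hm'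
  rw [Set.inter_eq_self_of_subset_right hVV'] at e1 e2
  rw [h.setLIntegral_forall_le_expNeg_tsum hg fun y hy => hgt y (hy.le.trans htt'),
    h.setLIntegral_forall_le_expNeg_tsum hg fun y hy => hgt y hy.le,
    ← h.measure_forall_le, ← h.measure_forall_le, ← hV, ← hV', ← e2, add_mul] at e1
  exact (ENNReal.add_right_inj (ENNReal.mul_ne_top (measure_ne_top _ _) (expNeg_ne_top _))).1 e1

/-- The mean measure puts no mass on (-∞, 0]. -/
lemma ae_forall_pos
    (h : IsPoissonPointProcess Y (volume.restrict (Set.Ioi 0)) μ) : ∀ᵐ ω ∂μ, ∀ k, 0 < Y k ω := by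
  rw [ae_all_iff]
  intro k
  have h0 : (volume.restrict (Set.Ioi (0 : ℝ))) (Set.Iic 0) = 0 := by
    rw [Measure.restrict_apply measurableSet_Iic, Set.Iic_inter_Ioi, Set.Ioc_self, measure_empty]
  rw [← h.sum_map_eq, Measure.sum_apply _ measurableSet_Iic, ENNReal.tsum_eq_zero] at h0
  have := h0 k
  rw [Measure.map_apply (h.measurable k) measurableSet_Iic] at this
  rw [ae_iff]
  simp only [not_lt]
  exact this

omit [MeasurableSpace Ω] in
lemma forall_le_iff {ω : Ω} (hR : IsLeast (Set.range fun k => Y k ω) (R ω)) (t : ℝ) :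
    (∀ k, t ≤ Y k ω) ↔ t ≤ R ω := by
  constructor
  · intro hk
    obtain ⟨k, hk'⟩ := hR.1
    exact (hk k).trans_eq hk'
  · exact fun ht k => ht.trans (hR.2 ⟨k, rfl⟩)

/-- The smallest point of a unit rate Poisson process on the half-line is exponential. -/
lemma map_isLeast_eq [IsProbabilityMeasure μ]
    (h : IsPoissonPointProcess Y (volume.restrict (Set.Ioi 0)) μ) (hRm : Measurable R)
    (hR : ∀ᵐ ω ∂μ, IsLeast (Set.range fun k => Y k ω) (R ω)) : μ.map R = expMeasure 1 := by
  have := isProbabilityMeasure_expMeasure one_pos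
  have : IsProbabilityMeasure (μ.map R) := Measure.isProbabilityMeasure_map hRm.aemeasurable
  have key : ∀ t : ℝ, 0 ≤ t → μ.map R (Set.Ici t) = expNeg (ENNReal.ofReal t) := by
    intro t ht
    rw [Measure.map_apply hRm measurableSet_Ici, ← h.measure_forall_le]
    refine measure_congr ?_
    filter_upwards [hR] with ω hω
    exact propext (forall_le_iff hω t).symm
  have h0 : ∀ ν : Measure ℝ, IsProbabilityMeasure ν → ν (Set.Ici 0) = 1 → ∀ t < 0,
      ν (Set.Ici t) = 1 := fun ν _ h1 t ht =>
    le_antisymm prob_le_one (h1 ▸ measure_mono (Set.Ici_subset_Ici.2 ht.le))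
  refine Measure.ext_of_Ici _ _ fun t => ?_
  rcases lt_or_ge t 0 with ht | ht
  · rw [h0 _ inferInstance (by rw [key 0 le_rfl]; simp) t ht,
      h0 _ inferInstance (by rw [expMeasure_Ici le_rfl]; simp) t ht]
  · rw [key t ht, expMeasure_Ici ht]

/-- Approximation of `r` from above by a multiple of `1 / n`. -/
noncomputable def gridAbove (n : ℕ) (r : ℝ) : ℝ := (⌊n * r⌋₊ + 1) / n

lemma lt_gridAbove {n : ℕ} (hn : 0 < n) (r : ℝ) : r < gridAbove n r := by
  rw [gridAbove, lt_div_iff₀ (by positivity), mul_comm]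
  exact Nat.lt_floor_add_one _

lemma gridAbove_le {n : ℕ} (hn : 0 < n) {r : ℝ} (hr : 0 ≤ r) : gridAbove n r ≤ r + 1 / n := by
  rw [gridAbove, div_le_iff₀ (by positivity), add_mul, one_div_mul_cancel (by positivity), mul_comm r]
  gcongr
  exact Nat.floor_le (by positivity)

lemma tendsto_gridAbove {r : ℝ} (hr : 0 ≤ r) : Tendsto (fun n => gridAbove n r) atTop (𝓝 r) := by
  have h1 : Tendsto (fun n : ℕ => r + 1 / (n : ℝ)) atTop (𝓝 r) := by
    simpa using tendsto_const_nhds.add (tendsto_one_div_atTop_nhds_zero_nat (𝕜 := ℝ))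
  refine tendsto_of_tendsto_of_tendsto_of_le_of_le' tendsto_const_nhds h1 ?_ ?_
  · filter_upwards [eventually_gt_atTop 0] with n hn using (lt_gridAbove hn r).le
  · filter_upwards [eventually_gt_atTop 0] with n hn using gridAbove_le hn hr

/-- Once the radius is discretised it is constant on each cell [i/n, (i+1)/n) of values of `R`, so
independence on each cell suffices. It applies because the grid value is the right end of the cell
and `G` ignores points up to it. -/
lemma lintegral_gridAbove_expNeg_tsum [IsProbabilityMeasure μ]
    (h : IsPoissonPointProcess Y (volume.restrict (Set.Ioi 0)) μ) (hRm : Measurable R)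
    (hR : ∀ᵐ ω ∂μ, IsLeast (Set.range fun k => Y k ω) (R ω)) {n : ℕ} (hn : 0 < n)
    (w : ℝ → ℝ≥0∞) {G : ℝ → ℝ → ℝ≥0∞} (hG : ∀ r, Measurable (G r))
    (hGr : ∀ r, ∀ y ≤ r, G r y = 0) :
    ∫⁻ ω, w (gridAbove n (R ω)) * expNeg (∑' k, G (gridAbove n (R ω)) (Y k ω)) ∂μ
      = ∫⁻ ω, w (gridAbove n (R ω))
          * expNeg (∫⁻ y in Set.Ioi 0, (1 - expNeg (G (gridAbove n (R ω)) y))) ∂μ := by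
  set N : Ω → ℕ := fun ω => ⌊n * R ω⌋₊ with hN
  have hNm : Measurable N := Nat.measurable_floor.comp (hRm.const_mul _)
  have hU : (⋃ i, N ⁻¹' {i}) = Set.univ := by ext; simp
  have hd : Pairwise (Function.onFun Disjoint fun i => N ⁻¹' {i}) := fun i j hij =>
    Disjoint.preimage _ (Set.disjoint_singleton.2 hij)
  have hsplit : ∀ f : Ω → ℝ≥0∞, ∫⁻ ω, f ω ∂μ = ∑' i, ∫⁻ ω in N ⁻¹' {i}, f ω ∂μ := by
    intro f
    rw [← setLIntegral_univ, ← hU, lintegral_iUnion (fun i => hNm (measurableSet_singleton i)) hd]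
  rw [hsplit, hsplit]
  refine tsum_congr fun i => ?_
  set t : ℝ := i / n
  set t' : ℝ := (i + 1) / n
  have hn' : (0 : ℝ) < n := by exact_mod_cast hn
  have ht : 0 ≤ t := by positivity
  have htt' : t ≤ t' := by simp only [t, t']; gcongr; linarith
  have hg : ∀ ω ∈ N ⁻¹' {i}, gridAbove n (R ω) = t' := by
    intro ω hω
    have : ⌊n * R ω⌋₊ = i := hω
    simp [gridAbove, this, t']
  -- A cell is a difference of two void events, up to a null set.
  have hset : (N ⁻¹' {i} : Set Ω) =ᵐ[μ]
      ({ω | ∀ k, t ≤ Y k ω} \ {ω | ∀ k, t' ≤ Y k ω} : Set Ω) := by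
    filter_upwards [hR, h.ae_forall_pos] with ω hω hpos
    refine propext ?_
    change ⌊n * R ω⌋₊ = i ↔ (∀ k, t ≤ Y k ω) ∧ ¬ (∀ k, t' ≤ Y k ω)
    have hRp : 0 ≤ R ω := (forall_le_iff hω 0).1 fun k => (hpos k).le
    rw [forall_le_iff hω, forall_le_iff hω, Nat.floor_eq_iff (by positivity), not_le,
      div_le_iff₀ hn', lt_div_iff₀ hn', mul_comm (R ω)]
  have hm := hNm (measurableSet_singleton i)
  have e1 : ∫⁻ ω in N ⁻¹' {i}, w (gridAbove n (R ω))
        * expNeg (∑' k, G (gridAbove n (R ω)) (Y k ω)) ∂μ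
      = ∫⁻ ω in N ⁻¹' {i}, w t' * expNeg (∑' k, G t' (Y k ω)) ∂μ :=
    setLIntegral_congr_fun hm fun ω hω => by simp only [hg ω hω]
  have e2 : ∫⁻ ω in N ⁻¹' {i}, w (gridAbove n (R ω))
        * expNeg (∫⁻ y in Set.Ioi 0, (1 - expNeg (G (gridAbove n (R ω)) y))) ∂μ
      = ∫⁻ ω in N ⁻¹' {i}, w t' * expNeg (∫⁻ y in Set.Ioi 0, (1 - expNeg (G t' y))) ∂μ :=
    setLIntegral_congr_fun hm fun ω hω => by simp only [hg ω hω]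
  rw [e1, e2,
    lintegral_const_mul _ (Measurable.tsum (f := fun k ω => G t' (Y k ω))
      fun k => (hG t').comp (h.measurable k)).expNeg,
    setLIntegral_const, Measure.restrict_congr_set hset, measure_congr hset,
    h.setLIntegral_diff_expNeg_tsum htt' (hG t') (hGr t')]
  ring

/-- The points beyond `r`, rescaled by `r`. -/
lemma lintegral_rescale {r : ℝ} (hr : 0 < r) {g : ℝ → ℝ≥0∞} (hg : Measurable g) :
    ∫⁻ y in Set.Ioi 0, (1 - expNeg (if r < y then g (y / r) else 0))
      = ENNReal.ofReal r * ∫⁻ u in Set.Ioi 1, (1 - expNeg (g u)) := by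
  set H : ℝ → ℝ≥0∞ := (Set.Ioi 1).indicator fun u => 1 - expNeg (g u) with hH
  have hHm : Measurable H := (hg.expNeg.const_sub 1).indicator measurableSet_Ioi
  have h1 : ∀ y, (Set.Ioi 0).indicator (fun y => 1 - expNeg (if r < y then g (y / r) else 0)) y
      = H (r⁻¹ * y) := by
    intro y
    rw [inv_mul_eq_div]
    by_cases hy : r < y
    · have h2 : 1 < y / r := (one_lt_div hr).2 hy
      rw [Set.indicator_of_mem (by exact hr.trans hy), hH, Set.indicator_of_mem (by exact h2), if_pos hy]
    · have h2 : ¬ 1 < y / r := by rwa [one_lt_div hr]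
      rw [hH, Set.indicator_of_notMem (s := Set.Ioi 1) (by exact h2)]
      by_cases hy0 : 0 < y
      · rw [Set.indicator_of_mem (by exact hy0), if_neg hy]; simp
      · rw [Set.indicator_of_notMem (by exact hy0)]
  rw [← lintegral_indicator measurableSet_Ioi, lintegral_congr h1,
    ← lintegral_map hHm (measurable_const_mul _), Real.map_volume_mul_left (by positivity),
    lintegral_smul_measure, hH, lintegral_indicator measurableSet_Ioi, inv_inv, abs_of_pos hr,
    smul_eq_mul]

/-- By Campbell's formula the mean is the integral of min(1, y⁻²), which is finite. This supplies
the dominating sum over points when the mesh tends to 0. -/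
lemma ae_tsum_inv_sq_lt_top
    (h : IsPoissonPointProcess Y (volume.restrict (Set.Ioi 0)) μ) :
    ∀ᵐ ω ∂μ, ∑' k, ENNReal.ofReal (if Y k ω ≤ 1 then 1 else 1 / Y k ω ^ 2) < ∞ := by
  have hm : Measurable fun y : ℝ => ENNReal.ofReal (if y ≤ 1 then 1 else 1 / y ^ 2) :=
    (Measurable.ite measurableSet_Iic measurable_const (by fun_prop)).ennreal_ofReal
  refine ae_lt_top (Measurable.tsum fun k => hm.comp (h.measurable k)) ?_
  rw [h.lintegral_tsum hm, ← Set.Ioc_union_Ioi_eq_Ioi zero_le_one,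
    lintegral_union measurableSet_Ioi (Set.disjoint_left.2 fun x hx hx' => hx.2.not_gt hx')]
  refine ENNReal.add_ne_top.2 ⟨?_, ?_⟩
  · rw [setLIntegral_congr_fun (g := fun _ => 1) measurableSet_Ioc fun y hy => by simp [hy.2]]
    simp
  · have hi : IntegrableOn (fun y : ℝ => y ^ (-2 : ℝ)) (Set.Ioi 1) :=
      integrableOn_Ioi_rpow_of_lt (by norm_num) one_pos
    refine ne_of_lt (lt_of_eq_of_lt ?_ hi.lintegral_lt_top)
    refine setLIntegral_congr_fun measurableSet_Ioi fun y hy => ?_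
    have hy : 1 < y := hy
    simp only [not_le.2 hy, if_false]
    rw [Real.rpow_neg (by linarith)]
    norm_num

/-- Expectations of functionals of the smallest point `R` of a unit rate Poisson process on the
half-line, and of the other points, rescaled by `R`. -/
theorem lintegral_isLeast_expNeg_tsum [IsProbabilityMeasure μ]
    (h : IsPoissonPointProcess Y (volume.restrict (Set.Ioi 0)) μ) (hRm : Measurable R)
    (hR : ∀ᵐ ω ∂μ, IsLeast (Set.range fun k => Y k ω) (R ω))
    {w : ℝ → ℝ≥0∞} (hw : Continuous w) (hw1 : ∀ r, w r ≤ 1)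
    {g : ℝ → ℝ≥0∞} (hg : Measurable g) (hgc : ContinuousOn g (Set.Ioi 1))
    {C : ℝ} (hgC : ∀ u, 1 < u → g u ≤ ENNReal.ofReal (C / u ^ 2)) :
    ∫⁻ ω, w (R ω) * expNeg (∑' k, if R ω < Y k ω then g (Y k ω / R ω) else 0) ∂μ
      = ∫⁻ r, w r * expNeg (ENNReal.ofReal r * ∫⁻ u in Set.Ioi 1, (1 - expNeg (g u)))
          ∂(expMeasure 1) := by
  set a := ∫⁻ u in Set.Ioi 1, (1 - expNeg (g u)) with ha
  set G : ℝ → ℝ → ℝ≥0∞ := fun r y => if r < y then g (y / r) else 0 with hG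
  have hGm : ∀ r, Measurable (G r) := fun r =>
    Measurable.ite measurableSet_Ioi (hg.comp (measurable_id.div_const r)) measurable_const
  have hpos : ∀ᵐ ω ∂μ, 0 < R ω := by
    filter_upwards [hR, h.ae_forall_pos] with ω hω hp
    obtain ⟨k, hk⟩ := hω.1
    exact (hp k).trans_eq hk
  have hgm : ∀ n, Measurable (gridAbove n) := fun n => by
    unfold gridAbove
    exact (((measurable_from_nat (f := fun i : ℕ => (i : ℝ))).comp
      (Nat.measurable_floor.comp (measurable_const_mul _))).add_const 1).div_const _
  rw [← h.map_isLeast_eq hRm hR, lintegral_map (by have := hw.measurable; fun_prop) hRm]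
  have hdisc : ∀ n, 0 < n →
      ∫⁻ ω, w (gridAbove n (R ω)) * expNeg (∑' k, G (gridAbove n (R ω)) (Y k ω)) ∂μ
        = ∫⁻ ω, w (gridAbove n (R ω)) * expNeg (ENNReal.ofReal (gridAbove n (R ω)) * a) ∂μ := by
    intro n hn
    rw [h.lintegral_gridAbove_expNeg_tsum hRm hR hn w hGm fun r y hy => by simp [hG, hy.not_gt]]
    refine lintegral_congr_ae ?_
    filter_upwards [hpos] with ω hω
    rw [← lintegral_rescale (hω.trans (lt_gridAbove hn _)) hg]
  have hGm2 : Measurable fun p : ℝ × ℝ => G p.1 p.2 :=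
    Measurable.ite (measurableSet_lt measurable_fst measurable_snd)
      (hg.comp (measurable_snd.div measurable_fst)) measurable_const
  have hL : Tendsto (fun n => ∫⁻ ω, w (gridAbove n (R ω))
      * expNeg (∑' k, G (gridAbove n (R ω)) (Y k ω)) ∂μ) atTop
      (𝓝 (∫⁻ ω, w (R ω) * expNeg (∑' k, G (R ω) (Y k ω)) ∂μ)) := by
    refine tendsto_lintegral_of_dominated_convergence (fun _ => 1) (fun n => ?_) (fun n => ?_)
      (by simp) ?_
    · refine (hw.measurable.comp ((hgm n).comp hRm)).mul (Measurable.expNeg ?_)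
      exact Measurable.tsum fun k => hGm2.comp (((hgm n).comp hRm).prodMk (h.measurable k))
    · exact ae_of_all _ fun ω => mul_le_one' (hw1 _) (expNeg_le_one _)
    · filter_upwards [hR, hpos, h.ae_tsum_inv_sq_lt_top] with ω hω hp hfin
      have hgrid := tendsto_gridAbove hp.le
      refine ENNReal.Tendsto.mul ((hw.tendsto _).comp hgrid) (Or.inr (expNeg_ne_top _))
        ((continuous_expNeg.tendsto _).comp ?_)
        (Or.inr ((hw1 _).trans_lt ENNReal.one_lt_top).ne)
      -- The shift makes the number of subdivisions positive and the mesh at most 1.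
      rw [← tendsto_add_atTop_iff_nat 1]
      simp_rw [← lintegral_count]
      -- The factor (R+1)² bounds the squared grid radius. The maximum handles points y ≤ 1, for
      -- which y ≥ R gives 1/y² ≤ 1/R².
      set K : ℝ := |C| * (R ω + 1) ^ 2 * max 1 (1 / R ω ^ 2) with hK
      have hK0 : 0 ≤ K := by positivity
      refine tendsto_lintegral_of_dominated_convergence' (fun k => ENNReal.ofReal K *
        ENNReal.ofReal (if Y k ω ≤ 1 then 1 else 1 / Y k ω ^ 2))
        (fun n => Measurable.of_discrete.aemeasurable) ?_ ?_ ?_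
      · intro n
        refine ae_of_all _ fun k => ?_
        set r := gridAbove (n + 1) (R ω) with hr
        have hRr : R ω < r := lt_gridAbove n.succ_pos _
        have hrR : r ≤ R ω + 1 := by
          refine (gridAbove_le n.succ_pos hp.le).trans (add_le_add_right ?_ _)
          rw [div_le_one (by positivity)]
          push_cast
          linarith [(Nat.cast_nonneg n : (0 : ℝ) ≤ n)]
        have hRy : R ω ≤ Y k ω := hω.2 ⟨k, rfl⟩
        have hy : 0 < Y k ω := hp.trans_le hRy
        simp only [hG]
        by_cases hry : r < Y k ω
        · rw [if_pos hry]
          have hr0 : 0 < r := hp.trans hRr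
          refine (hgC _ ((one_lt_div hr0).2 hry)).trans ?_
          rw [← ENNReal.ofReal_mul hK0]
          refine ENNReal.ofReal_le_ofReal ?_
          have h1 : C / (Y k ω / r) ^ 2 ≤ |C| * (R ω + 1) ^ 2 * (1 / Y k ω ^ 2) := by
            calc C / (Y k ω / r) ^ 2 = C * (r ^ 2 * (1 / Y k ω ^ 2)) := by field_simp
              _ ≤ |C| * ((R ω + 1) ^ 2 * (1 / Y k ω ^ 2)) := by
                gcongr
                exact le_abs_self C
              _ = _ := by ring
          refine h1.trans ?_
          rw [hK, mul_assoc (|C| * (R ω + 1) ^ 2)]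
          gcongr
          split_ifs with h1
          · rw [mul_one]
            refine le_trans ?_ (le_max_right _ _)
            gcongr
          · exact le_mul_of_one_le_left (by positivity) (le_max_left _ _)
        · rw [if_neg hry]
          exact zero_le
      · rw [lintegral_count, ENNReal.tsum_mul_left]
        exact ENNReal.mul_ne_top ENNReal.ofReal_ne_top hfin.ne
      · refine ae_of_all _ fun k => ?_
        have hgrid' := (tendsto_add_atTop_iff_nat 1).2 hgrid
        simp only [hG]
        by_cases hk : R ω < Y k ω
        · rw [if_pos hk]
          have h1 : 1 < Y k ω / R ω := (one_lt_div hp).2 hk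
          have h2 := (hgc.continuousAt (Ioi_mem_nhds h1)).tendsto.comp
            (tendsto_const_nhds (x := Y k ω).div hgrid' hp.ne')
          refine h2.congr' ?_
          filter_upwards [hgrid'.eventually_lt_const hk] with n hn
          rw [if_pos hn]
          rfl
        · rw [if_neg hk]
          -- The grid lies strictly above `R`, so the point `R` itself never contributes along the
          -- approximation, in agreement with the limit. This is why the approximation is from
          -- above.
          refine tendsto_const_nhds.congr fun n => ?_
          rw [if_neg]
          exact fun h' => hk ((lt_gridAbove n.succ_pos _).trans h')
  have hRR : Tendsto (fun n => ∫⁻ ω, w (gridAbove n (R ω))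
      * expNeg (ENNReal.ofReal (gridAbove n (R ω)) * a) ∂μ) atTop
      (𝓝 (∫⁻ ω, w (R ω) * expNeg (ENNReal.ofReal (R ω) * a) ∂μ)) := by
    refine tendsto_lintegral_of_dominated_convergence (fun _ => 1) (fun n => ?_) (fun n => ?_)
      (by simp) ?_
    · exact (hw.measurable.comp ((hgm n).comp hRm)).mul
        (Measurable.expNeg (((hgm n).comp hRm).ennreal_ofReal.mul_const _))
    · exact ae_of_all _ fun ω => mul_le_one' (hw1 _) (expNeg_le_one _)
    · filter_upwards [hpos] with ω hp
      have hgrid := tendsto_gridAbove hp.le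
      refine ENNReal.Tendsto.mul ((hw.tendsto _).comp hgrid) (Or.inr (expNeg_ne_top _))
        ((continuous_expNeg.tendsto _).comp ?_)
        (Or.inr ((hw1 _).trans_lt ENNReal.one_lt_top).ne)
      exact ENNReal.Tendsto.mul_const (ENNReal.tendsto_ofReal hgrid)
        (Or.inl (by simpa using hp))
  refine tendsto_nhds_unique (hL.congr' ?_) hRR
  filter_upwards [eventually_gt_atTop 0] with n hn using hdisc n hn

end IsPoissonPointProcess

/-- Laplace transform of the exponential distribution. -/
lemma lintegral_expNeg_expMeasure {s : ℝ} (hs : 0 ≤ s) :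
    ∫⁻ x, expNeg (ENNReal.ofReal (s * x)) ∂(expMeasure 1) = ENNReal.ofReal (1 / (1 + s)) := by
  have h1 : ∀ x, gammaPDF 1 1 x * expNeg (ENNReal.ofReal (s * x))
      = ENNReal.ofReal (1 / (1 + s)) * exponentialPDF (1 + s) x := by
    intro x
    change exponentialPDF 1 x * _ = _
    rcases lt_or_ge x 0 with hx | hx
    · simp [exponentialPDF_of_neg hx]
    · rw [exponentialPDF_of_nonneg hx, exponentialPDF_of_nonneg hx,
        expNeg_ofReal (mul_nonneg hs hx), ← ENNReal.ofReal_mul (by positivity),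
        ← ENNReal.ofReal_mul (by positivity)]
      congr 1
      rw [one_mul, one_mul, ← Real.exp_add, ← mul_assoc, one_div_mul_cancel (by positivity), one_mul]
      congr 1
      ring
  have hm : Measurable (gammaPDF 1 1) := (measurable_gammaPDFReal 1 1).ennreal_ofReal
  have hm' : Measurable (exponentialPDF (1 + s)) :=
    (measurable_exponentialPDFReal (1 + s)).ennreal_ofReal
  rw [expMeasure, gammaMeasure, lintegral_withDensity_eq_lintegral_mul _ hm (by fun_prop)]
  simp only [Pi.mul_apply]
  rw [lintegral_congr h1, lintegral_const_mul _ hm',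
    lintegral_exponentialPDF_eq_one (by positivity), mul_one]

lemma expMeasure_setOf_le_ofReal (y : ℝ≥0∞) :
    expMeasure 1 {x | y ≤ ENNReal.ofReal x} = expNeg y := by
  have := isProbabilityMeasure_expMeasure one_pos
  -- For y = 0 the set is the whole line, since `ENNReal.ofReal` truncates negative numbers, rather
  -- than a half-line starting at 0.
  rcases eq_or_ne y 0 with rfl | hy0
  · simp
  induction y with
  | top => simp
  | coe y =>
    have hy : (0 : ℝ) < y := by
      rw [NNReal.coe_pos]
      exact pos_iff_ne_zero.2 (by simpa using hy0)
    have h1 : {x : ℝ | (y : ℝ≥0∞) ≤ ENNReal.ofReal x} = Set.Ici (y : ℝ) := by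
      ext x
      rw [Set.mem_Ici, ← ENNReal.ofReal_coe_nnreal]
      change ENNReal.ofReal y ≤ ENNReal.ofReal x ↔ _
      rw [ENNReal.ofReal_le_ofReal_iff']
      constructor
      · rintro (h | h)
        · exact h
        · exact absurd h hy.not_ge
      · exact Or.inl
    rw [h1, expMeasure_Ici hy.le, ENNReal.ofReal_coe_nnreal]

/-! ### Independent marks -/

section Marks

variable {Ω M : Type*} [MeasurableSpace Ω] [MeasurableSpace M] {μ : Measure Ω}
  {ν : Measure M} {m : ℕ → Ω → M}

/-- Independence factors the partial sums; bounded convergence passes to the full series. -/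
lemma lintegral_expNeg_tsum_of_iIndepFun [IsProbabilityMeasure μ] (hm : ∀ k, Measurable (m k))
    (hind : iIndepFun m μ) (hlaw : ∀ k, μ.map (m k) = ν) {J : ℕ → M → ℝ≥0∞}
    (hJ : ∀ k, Measurable (J k)) {c : ℕ → ℝ≥0∞} (hc : ∀ k, ∫⁻ x, expNeg (J k x) ∂ν = expNeg (c k)) :
    ∫⁻ ω, expNeg (∑' k, J k (m k ω)) ∂μ = expNeg (∑' k, c k) := by
  have hn : ∀ n, ∫⁻ ω, expNeg (∑ k ∈ Finset.range n, J k (m k ω)) ∂μ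
      = expNeg (∑ k ∈ Finset.range n, c k) := by
    intro n
    simp_rw [expNeg_sum]
    rw [lintegral_prod_eq_prod_lintegral_of_indepFun _ (fun k ω => expNeg (J k (m k ω)))
      (hind.comp (fun k x => expNeg (J k x)) fun k => (hJ k).expNeg)
      fun k => ((hJ k).comp (hm k)).expNeg]
    refine Finset.prod_congr rfl fun k _ => ?_
    rw [← hc, ← hlaw k, lintegral_map (hJ k).expNeg (hm k)]
  have hR : Tendsto (fun n => expNeg (∑ k ∈ Finset.range n, c k)) atTop (𝓝 (expNeg (∑' k, c k))) :=
    (continuous_expNeg.tendsto _).comp (ENNReal.tendsto_nat_tsum c)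
  refine tendsto_nhds_unique (Tendsto.congr hn ?_) hR
  refine tendsto_lintegral_of_dominated_convergence (fun _ => 1) (fun n => ?_) (fun n => ?_)
    (by simp) ?_
  · exact (Finset.measurable_fun_sum _ fun k _ => (hJ k).comp (hm k)).expNeg
  · exact ae_of_all _ fun ω => expNeg_le_one _
  · exact ae_of_all _ fun ω => (continuous_expNeg.tendsto _).comp (ENNReal.tendsto_nat_tsum _)

/-- Because `J k₀ = 0`, the sum is measurable for the σ-algebra generated by the marks other than `m
k₀`, which is independent of `m k₀`. It separates the serving fading from the interference. -/
lemma indepFun_tsum_of_iIndepFun (hm : ∀ k, Measurable (m k)) (hind : iIndepFun m μ)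
    {J : ℕ → M → ℝ≥0∞} (hJ : ∀ k, Measurable (J k)) (k₀ : ℕ) (hJ0 : J k₀ = 0) :
    IndepFun (m k₀) (fun ω => ∑' k, J k (m k ω)) μ := by
  have h := indep_iSup_of_disjoint (fun k => (hm k).comap_le) hind.iIndep
    (S := {k₀}) (T := {k₀}ᶜ) disjoint_compl_right
  have htsum : ∀ (m' : MeasurableSpace Ω) (f : ℕ → Ω → ℝ≥0∞), (∀ k, Measurable[m'] (f k)) →
      Measurable[m'] fun ω => ∑' k, f k ω := fun m' f hf => Measurable.tsum hf
  rw [IndepFun_iff_Indep]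
  refine indep_of_indep_of_le_left (indep_of_indep_of_le_right h ?_) ?_
  · rw [← measurable_iff_comap_le]
    refine htsum _ _ fun k => ?_
    by_cases hk : k = k₀
    · subst hk
      simp only [hJ0, Pi.zero_apply]
      exact @measurable_const _ _ _ (_) _
    · refine (hJ k).comp ?_
      rw [measurable_iff_comap_le]
      exact le_iSup₂_of_le k hk le_rfl
  · exact le_iSup₂_of_le k₀ rfl le_rfl

/-- Probability that an exponential component of the mark `m k₀` exceeds an independent sum of
functions of the other marks. -/
lemma measure_add_tsum_le_ofReal [IsProbabilityMeasure μ] (hm : ∀ k, Measurable (m k))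
    (hind : iIndepFun m μ) (hlaw : ∀ k, μ.map (m k) = ν) {H : M → ℝ} (hH : Measurable H)
    (hHlaw : ν.map H = expMeasure 1) {J : ℕ → M → ℝ≥0∞} (hJ : ∀ k, Measurable (J k)) {c : ℕ → ℝ≥0∞}
    (hc : ∀ k, ∫⁻ x, expNeg (J k x) ∂ν = expNeg (c k)) (k₀ : ℕ) (hJ0 : J k₀ = 0) (y : ℝ≥0∞) :
    μ {ω | y + ∑' k, J k (m k ω) ≤ ENNReal.ofReal (H (m k₀ ω))}
      = expNeg y * expNeg (∑' k, c k) := by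
  have := isProbabilityMeasure_expMeasure one_pos
  set Z : Ω → ℝ≥0∞ := fun ω => ∑' k, J k (m k ω) with hZ
  have hZm : Measurable Z := Measurable.tsum fun k => (hJ k).comp (hm k)
  have hHm : Measurable fun ω => H (m k₀ ω) := hH.comp (hm k₀)
  have hI : IndepFun Z (fun ω => H (m k₀ ω)) μ :=
    ((indepFun_tsum_of_iIndepFun hm hind hJ k₀ hJ0).comp hH measurable_id).symm
  have hprod := (indepFun_iff_map_prod_eq_prod_map_map hZm.aemeasurable hHm.aemeasurable).1 hI
  have hlawH : μ.map (fun ω => H (m k₀ ω)) = expMeasure 1 := by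
    rw [← hHlaw, ← hlaw k₀, Measure.map_map hH (hm k₀)]
    rfl
  have hS : MeasurableSet {p : ℝ≥0∞ × ℝ | y + p.1 ≤ ENNReal.ofReal p.2} :=
    measurableSet_le (by fun_prop) (by fun_prop)
  have e1 : {ω | y + Z ω ≤ ENNReal.ofReal (H (m k₀ ω))}
      = (fun ω => (Z ω, H (m k₀ ω))) ⁻¹' {p : ℝ≥0∞ × ℝ | y + p.1 ≤ ENNReal.ofReal p.2} := rfl
  rw [e1, ← Measure.map_apply (hZm.prodMk hHm) hS, hprod, hlawH, Measure.prod_apply hS]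
  -- With the sum frozen at z, this is the exponential tail at y + z, which splits as a product.
  have e2 : ∀ z : ℝ≥0∞, expMeasure 1 (Prod.mk z ⁻¹' {p : ℝ≥0∞ × ℝ | y + p.1 ≤ ENNReal.ofReal p.2})
      = expNeg y * expNeg z := fun z => by
    rw [← expNeg_add, ← expMeasure_setOf_le_ofReal]
    rfl
  rw [lintegral_congr e2, lintegral_const_mul _ measurable_expNeg,
    lintegral_map measurable_expNeg hZm, lintegral_expNeg_tsum_of_iIndepFun hm hind hlaw hJ hc]

end Marks

/-- Conditioning on the first of two independent random variables. -/
lemma ProbabilityTheory.IndepFun.measure_prodMk_mem {Ω E F : Type*} [MeasurableSpace Ω]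
    [MeasurableSpace E] [MeasurableSpace F] {μ : Measure Ω} [IsFiniteMeasure μ] {X : Ω → E}
    {Z : Ω → F} (h : IndepFun X Z μ) (hX : Measurable X) (hZ : Measurable Z) {S : Set (E × F)}
    (hS : MeasurableSet S) :
    μ {ω | (X ω, Z ω) ∈ S} = ∫⁻ ω', μ {ω | (X ω', Z ω) ∈ S} ∂μ := by
  have hprod := (indepFun_iff_map_prod_eq_prod_map_map hX.aemeasurable hZ.aemeasurable).1 h
  have e1 : {ω | (X ω, Z ω) ∈ S} = (fun ω => (X ω, Z ω)) ⁻¹' S := rfl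
  rw [e1, ← Measure.map_apply (hX.prodMk hZ) hS, hprod, Measure.prod_apply hS,
    lintegral_map (measurable_measure_prodMk_left hS) hX]
  refine lintegral_congr fun ω' => ?_
  rw [Measure.map_apply hZ (measurable_prodMk_left hS)]
  rfl

/-- Laplace transform of the interference caused by one station, which is present with
probability `p`. -/
lemma lintegral_expNeg_thinned {K : Type*} [MeasurableSpace K] {κ : Measure K}
    [IsProbabilityMeasure κ] {A : Set K} [DecidablePred (· ∈ A)] (hA : MeasurableSet A) {p : ℝ}
    (hp0 : 0 ≤ p) (hp1 : p ≤ 1) (hpA : κ A = ENNReal.ofReal p) {s : ℝ} (hs : 0 ≤ s) :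
    ∫⁻ x, expNeg (if x.2 ∈ A then ENNReal.ofReal (s * x.1) else 0) ∂((expMeasure 1).prod κ)
      = ENNReal.ofReal (1 - p + p / (1 + s)) := by
  have := isProbabilityMeasure_expMeasure one_pos
  have hm : Measurable fun x : ℝ × K =>
      expNeg (if x.2 ∈ A then ENNReal.ofReal (s * x.1) else 0) :=
    (Measurable.ite (measurable_snd hA) (by fun_prop) measurable_const).expNeg
  rw [lintegral_prod_symm' _ hm]
  have h1 : ∀ b : K, ∫⁻ x, expNeg (if b ∈ A then ENNReal.ofReal (s * x) else 0) ∂(expMeasure 1)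
      = A.indicator (fun _ => ENNReal.ofReal (1 / (1 + s))) b + Aᶜ.indicator (fun _ => 1) b := by
    intro b
    by_cases hb : b ∈ A
    · simp [hb, lintegral_expNeg_expMeasure hs]
    · simp [hb]
  rw [lintegral_congr h1, lintegral_add_left (measurable_const.indicator hA),
    lintegral_indicator_const hA, lintegral_indicator_const hA.compl, hpA, prob_compl_eq_one_sub hA,
    hpA, one_mul, ← ENNReal.ofReal_one, ← ENNReal.ofReal_sub _ hp0,
    ← ENNReal.ofReal_mul (by positivity), ← ENNReal.ofReal_add (by positivity) (by linarith)]
  congr 1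
  ring

/-! ### Attenuation of the Laplace functional by one interferer -/

/-- `-log (1 - p + p / (1 + θ / u²))`: here `u` is the ratio of the squared distances of the
interferer and of the serving station, for the path-loss exponent `4`. -/
noncomputable def attenuation (p θ u : ℝ) : ℝ≥0∞ :=
  ENNReal.ofReal (-Real.log (1 - p + p / (1 + θ / u ^ 2)))

section Attenuation

variable {p θ : ℝ}

/-- The right side is a convex combination of 1 and 1/(1+s), the latter being at most 1. -/
lemma inv_one_add_le_thinned (hp1 : p ≤ 1) {s : ℝ} (hs : 0 ≤ s) :
    1 / (1 + s) ≤ 1 - p + p / (1 + s) := by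
  have h : 1 / (1 + s) ≤ 1 := (div_le_one (by positivity)).2 (by linarith)
  have : 1 - p + p / (1 + s) - 1 / (1 + s) = (1 - p) * (1 - 1 / (1 + s)) := by ring
  nlinarith

lemma thinned_pos (hp1 : p ≤ 1) {s : ℝ} (hs : 0 ≤ s) : 0 < 1 - p + p / (1 + s) :=
  lt_of_lt_of_le (by positivity) (inv_one_add_le_thinned hp1 hs)

lemma thinned_le_one (hp0 : 0 ≤ p) {s : ℝ} (hs : 0 ≤ s) : 1 - p + p / (1 + s) ≤ 1 := by
  have : p / (1 + s) ≤ p := div_le_self hp0 (by linarith)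
  linarith

lemma measurable_attenuation : Measurable (attenuation p θ) := by
  unfold attenuation
  fun_prop

lemma continuousOn_attenuation (hp1 : p ≤ 1) (hθ : 0 ≤ θ) :
    ContinuousOn (attenuation p θ) (Set.Ioi 1) := by
  unfold attenuation
  refine ENNReal.continuous_ofReal.comp_continuousOn (ContinuousOn.neg (ContinuousOn.log ?_ ?_))
  · intro u hu
    have hu0 : (0 : ℝ) < u := one_pos.trans hu
    refine ContinuousAt.continuousWithinAt ?_
    have h1 : u ^ 2 ≠ 0 := by positivity
    have h2 : 1 + θ / u ^ 2 ≠ 0 := by positivity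
    fun_prop (disch := assumption)
  · exact fun u hu => (thinned_pos hp1 (by positivity)).ne'

lemma expNeg_attenuation (hp0 : 0 ≤ p) (hp1 : p ≤ 1) (hθ : 0 ≤ θ) (u : ℝ) :
    expNeg (attenuation p θ u) = ENNReal.ofReal (1 - p + p / (1 + θ / u ^ 2)) := by
  have hs : 0 ≤ θ / u ^ 2 := by positivity
  have hpos := thinned_pos hp1 hs
  rw [attenuation, expNeg_ofReal, neg_neg, Real.exp_log hpos]
  exact neg_nonneg.2 (Real.log_nonpos hpos.le (thinned_le_one hp0 hs))

/-- With s = θ/u², the bound is -log(1 - p + p/(1+s)) ≤ log(1+s) ≤ s. This u⁻² decay is what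
dominates the sum over stations. -/
lemma attenuation_le (hp1 : p ≤ 1) (hθ : 0 ≤ θ) (u : ℝ) :
    attenuation p θ u ≤ ENNReal.ofReal (θ / u ^ 2) := by
  have hs : 0 ≤ θ / u ^ 2 := by positivity
  refine ENNReal.ofReal_le_ofReal ?_
  have h1 := Real.log_le_log (by positivity) (inv_one_add_le_thinned hp1 hs)
  rw [one_div, Real.log_inv] at h1
  have h2 := Real.log_le_sub_one_of_pos (show 0 < 1 + θ / u ^ 2 by positivity)
  linarith

/-- The integrand is pθ/(θ+u²), with primitive p√θ arctan(u/√θ). Between 1 and ∞ this leaves π/2 -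
arctan(1/√θ) = arctan √θ. -/
lemma lintegral_one_sub_expNeg_attenuation (hp0 : 0 ≤ p) (hp1 : p ≤ 1) (hθ : 0 < θ) :
    ∫⁻ u in Set.Ioi 1, (1 - expNeg (attenuation p θ u))
      = ENNReal.ofReal (p * (Real.sqrt θ * Real.arctan (Real.sqrt θ))) := by
  set s := Real.sqrt θ with hs
  have hs0 : 0 < s := Real.sqrt_pos.2 hθ
  have hsq : s ^ 2 = θ := Real.sq_sqrt hθ.le
  have h1 : ∀ u ∈ Set.Ioi (1 : ℝ), 1 - expNeg (attenuation p θ u)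
      = ENNReal.ofReal (p * (θ / (θ + u ^ 2))) := by
    intro u hu
    have hu0 : (0 : ℝ) < u := one_pos.trans hu
    rw [expNeg_attenuation hp0 hp1 hθ.le, ← ENNReal.ofReal_one,
      ← ENNReal.ofReal_sub _ (thinned_pos hp1 (by positivity)).le]
    congr 1
    field_simp
    ring
  have hderiv : ∀ u ∈ Set.Ici (1 : ℝ), HasDerivAt (fun u => p * (s * Real.arctan (u / s)))
      (p * (θ / (θ + u ^ 2))) u := by
    intro u _
    have h := ((((hasDerivAt_id u).div_const s).arctan).const_mul s).const_mul p
    convert! h using 1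
    simp only [id]
    rw [← hsq]
    field_simp
  have hlim : Tendsto (fun u => p * (s * Real.arctan (u / s))) atTop
      (𝓝 (p * (s * (Real.pi / 2)))) := by
    refine Tendsto.const_mul _ (Tendsto.const_mul _ ?_)
    exact (Real.tendsto_arctan_atTop.mono_right nhdsWithin_le_nhds).comp
      (tendsto_id.atTop_div_const hs0)
  have hnn : ∀ u ∈ Set.Ioi (1 : ℝ), 0 ≤ p * (θ / (θ + u ^ 2)) := fun u _ => by positivity
  have hint := integral_Ioi_of_hasDerivAt_of_nonneg' hderiv hnn hlim
  have hi := integrableOn_Ioi_deriv_of_nonneg' hderiv hnn hlim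
  rw [setLIntegral_congr_fun measurableSet_Ioi h1, ← ofReal_integral_eq_lintegral_ofReal hi
    ((ae_restrict_iff' measurableSet_Ioi).2 (ae_of_all _ hnn)), hint, one_div,
    Real.arctan_inv_of_pos hs0]
  congr 1
  ring

end Attenuation

/-! ### Squared distances of the points of a planar Poisson process -/

/-- The disc on which πφ‖x‖² ≤ b has area b/φ, hence intensity b. The two measures therefore agree
on half-open intervals. -/
lemma map_normSq_volume_eq {φ : ℝ} (hφ : 0 < φ) :
    (ENNReal.ofReal φ • (volume : Measure (EuclideanSpace ℝ (Fin 2)))).map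
      (fun x => Real.pi * φ * ‖x‖ ^ 2) = volume.restrict (Set.Ioi 0) := by
  have hπ := Real.pi_pos
  have hm : Measurable fun x : EuclideanSpace ℝ (Fin 2) => Real.pi * φ * ‖x‖ ^ 2 := by fun_prop
  set ν := (ENNReal.ofReal φ • (volume : Measure (EuclideanSpace ℝ (Fin 2)))).map
      (fun x => Real.pi * φ * ‖x‖ ^ 2) with hν
  have key : ∀ b, ν (Set.Iic b) = ENNReal.ofReal b := by
    intro b
    rw [hν, Measure.map_apply hm measurableSet_Iic]
    rcases lt_or_ge b 0 with hb | hb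
    · rw [ENNReal.ofReal_of_nonpos hb.le]
      refine (congrArg _ ?_).trans measure_empty
      ext x
      simp only [Set.mem_preimage, Set.mem_Iic, Set.mem_empty_iff_false, iff_false, not_le]
      exact hb.trans_le (by positivity)
    · have h1 : (fun x : EuclideanSpace ℝ (Fin 2) => Real.pi * φ * ‖x‖ ^ 2) ⁻¹' Set.Iic b
          = Metric.closedBall 0 (Real.sqrt (b / (Real.pi * φ))) := by
        ext x
        rw [Set.mem_preimage, Set.mem_Iic, mem_closedBall_zero_iff, Real.le_sqrt (norm_nonneg _),
          le_div_iff₀ (by positivity), mul_comm]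
        positivity
      rw [h1, Measure.smul_apply, EuclideanSpace.volume_closedBall_fin_two, smul_eq_mul,
        ← ENNReal.ofReal_pow (Real.sqrt_nonneg _), Real.sq_sqrt (by positivity),
        ← ENNReal.ofReal_mul (by positivity),
        ← ENNReal.ofReal_mul hφ.le]
      congr 1
      field_simp
  refine (Measure.ext_of_Ioc _ _ fun a b hab => ?_).symm
  have h1 : Set.Ioc a b = Set.Iic b \ Set.Iic a := by
    ext x; simp [and_comm]
  have h2 : Set.Ioc a b ∩ Set.Ioi 0 = Set.Ioc (max a 0) b := by
    ext x; simp
  rw [Measure.restrict_apply measurableSet_Ioc, h2, Real.volume_Ioc, h1,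
    measure_sdiff (Set.Iic_subset_Iic.2 hab.le) measurableSet_Iic.nullMeasurableSet
      (by rw [key]; exact ENNReal.ofReal_ne_top), key, key]
  rcases le_total a 0 with ha | ha
  · rw [max_eq_right ha, ENNReal.ofReal_of_nonpos ha, sub_zero, tsub_zero]
  · rw [max_eq_left ha, ENNReal.ofReal_sub _ ha]

/-- Almost surely only finitely many indices have a point below any given integer. Choosing an
integer above `Y 0`, the minimum over those indices is global. -/
lemma IsPoissonPointProcess.ae_exists_le {Ω : Type*} [MeasurableSpace Ω] {μ : Measure Ω}
    {Y : ℕ → Ω → ℝ} (h : IsPoissonPointProcess Y (volume.restrict (Set.Ioi 0)) μ) :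
    ∀ᵐ ω ∂μ, ∃ k, ∀ j, Y k ω ≤ Y j ω := by
  have hfin : ∀ n : ℕ, ∀ᵐ ω ∂μ, pointCount Y (Set.Iic (n : ℝ)) ω < ∞ := by
    intro n
    have hf : (volume.restrict (Set.Ioi (0 : ℝ))) (Set.Iic (n : ℝ)) < ∞ := by
      rw [Measure.restrict_apply measurableSet_Iic, Set.Iic_inter_Ioi]
      exact measure_Ioc_lt_top
    refine ae_lt_top (measurable_pointCount h.measurable measurableSet_Iic) ?_
    rw [h.lintegral_pointCount measurableSet_Iic hf]
    exact hf.ne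
  filter_upwards [ae_all_iff.2 hfin] with ω hω
  obtain ⟨n, hn⟩ := exists_nat_ge (Y 0 ω)
  have hF := ENNReal.finite_const_le_of_tsum_ne_top (hω n).ne one_ne_zero
  have hsub : ∀ k, Y k ω ≤ n →
      k ∈ {i | (1 : ℝ≥0∞) ≤ (Set.Iic (n : ℝ)).indicator (1 : ℝ → ℝ≥0∞) (Y i ω)} := by
    intro k hk
    rw [Set.mem_ofPred_eq, Set.indicator_of_mem (by exact hk)]
    rfl
  obtain ⟨k, _, hk⟩ := Set.exists_min_image _ (fun k => Y k ω) hF ⟨0, hsub 0 hn⟩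
  refine ⟨k, fun j => ?_⟩
  rcases le_or_gt (Y j ω) n with hj | hj
  · exact hk j (hsub j hj)
  · exact (hk 0 (hsub 0 hn)).trans (hn.trans hj.le)

/-! ### Parameters of the network -/

instance isProbabilityMeasure_queueLaw (r : ℝ≥0) (k : ℕ) : IsProbabilityMeasure (queueLaw r k) := by
  induction k with
  | zero => rw [queueLaw]; infer_instance
  | succ k ih =>
    refine ⟨?_⟩
    have := lintegral_queueLaw_succ r k fun _ => 1
    simpa using this

lemma emptyQueueProb_le_one (r : ℝ≥0) : emptyQueueProb r ≤ 1 :=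
  le_of_tendsto' (tendsto_queueLaw_zero r) fun _ => prob_le_one

namespace CacheNetwork

variable (net : CacheNetwork)

/-- The most popular packet has positive popularity, otherwise the total could not be 1, and it is
cached since M ≥ 1. Strictness in `uncachedProb_lt_one` depends on this. -/
lemma hitRatio_pos : 0 < net.hitRatio := by
  have hC : 0 < net.C := net.one_le_M.trans net.M_le_C
  have h0 : 0 < net.f ⟨0, hC⟩ := by
    by_contra hneg
    have : ∀ i, net.f i ≤ 0 := fun i =>
      (net.f_antitone (Fin.mk_le_of_le_val (Nat.zero_le _))).trans (not_lt.1 hneg)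
    have := Finset.sum_nonpos fun i (_ : i ∈ Finset.univ) => this i
    rw [net.f_sum] at this
    linarith
  refine Finset.sum_pos' (fun i _ => ?_) ⟨⟨0, hC⟩, Finset.mem_univ _, ?_⟩
  · split_ifs
    exacts [net.f_nonneg i, le_rfl]
  · rwa [if_pos (show 0 < net.M from net.one_le_M)]

lemma Tbar_pos : 0 < net.Tbar := by
  have := net.T_pos
  have := net.τ_pos
  have := net.B_pos
  exact sub_pos.2 (Real.one_lt_rpow one_lt_two (by positivity))

lemma measurable_poissonMeasure_singleton (n : ℕ) :
    Measurable fun s : ℝ => poissonMeasure (net.φu * s).toNNReal {n} := by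
  simp_rw [poissonMeasure_singleton]
  fun_prop

lemma tsum_usersProb : ∑' n, net.usersProb n = 1 := by
  have hb : 0 < net.φb * 3.575 := mul_pos net.φb_pos (by norm_num)
  have := isProbabilityMeasure_gammaMeasure (a := 3.575) (by norm_num) hb
  unfold usersProb
  rw [← lintegral_tsum fun n => (net.measurable_poissonMeasure_singleton n).aemeasurable]
  have h1 : ∀ s : ℝ, ∑' n, poissonMeasure (net.φu * s).toNNReal {n} = 1 := by
    intro s
    have := lintegral_countable' (μ := poissonMeasure (net.φu * s).toNNReal) fun _ => 1
    simpa using this.symm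
  simp [h1]

/-- The Gamma law lives on positive sizes, and a Poisson law with positive mean charges every
integer. Large cells thus occur, which makes `pFull`, and then `activeProb`, positive. -/
lemma usersProb_pos (n : ℕ) : 0 < net.usersProb n := by
  have hb : 0 < net.φb * 3.575 := mul_pos net.φb_pos (by norm_num)
  have := isProbabilityMeasure_gammaMeasure (a := 3.575) (by norm_num) hb
  rw [pos_iff_ne_zero]
  intro h0
  unfold usersProb at h0
  rw [lintegral_eq_zero_iff (net.measurable_poissonMeasure_singleton n)] at h0
  have hpos : ∀ᵐ s ∂(gammaMeasure 3.575 (net.φb * 3.575)), 0 < s := by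
    rw [ae_iff, gammaMeasure]
    simp only [not_lt]
    change (volume.withDensity _) (Set.Iic 0) = 0
    rw [withDensity_apply _ measurableSet_Iic, ← lintegral_gammaPDF_of_nonpos (le_refl (0 : ℝ)),
      restrict_Iio_eq_restrict_Iic]
  obtain ⟨s, hs, hs0⟩ := (h0.and hpos).exists
  have h1 := poissonMeasure_real_singleton_pos n
    (show 0 < (net.φu * s).toNNReal from Real.toNNReal_pos.2 (mul_pos net.φu_pos hs0))
  have hs' : poissonMeasure (net.φu * s).toNNReal {n} = 0 := hs
  rw [measureReal_def, hs'] at h1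
  simp at h1

lemma tsum_ite_le_one {P : ℕ → Prop} [DecidablePred P] {v : ℕ → ℝ≥0∞}
    (hv : ∀ n, v n ≤ net.usersProb n) : ∑' n, (if P n then v n else 0) ≤ 1 := by
  rw [← net.tsum_usersProb]
  refine ENNReal.tsum_le_tsum fun n => ?_
  split_ifs
  exacts [hv n, zero_le]

lemma pFull_le_one : net.pFull ≤ 1 :=
  ENNReal.toReal_le_of_le_ofReal zero_le_one (by
    rw [ENNReal.ofReal_one]; exact net.tsum_ite_le_one fun n => le_rfl)

lemma pFree_le_one : net.pFree ≤ 1 :=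
  ENNReal.toReal_le_of_le_ofReal zero_le_one (by
    rw [ENNReal.ofReal_one]
    exact net.tsum_ite_le_one fun n => mul_le_of_le_one_right' (emptyQueueProb_le_one _))

lemma pFree_nonneg : 0 ≤ net.pFree := ENNReal.toReal_nonneg

lemma mul_hitRatio_lt_one (hδ : net.hitRatio < 1) : net.α * net.hitRatio < 1 := by
  have := net.hitRatio_pos
  nlinarith [net.α_lt_one, net.α_pos]

lemma pFull_pos (hδ : net.hitRatio < 1) : 0 < net.pFull := by
  classical
  have hl : 0 < net.lamBar * net.τ :=
    mul_pos (mul_pos (sub_pos.2 (net.mul_hitRatio_lt_one hδ)) net.lam_pos) net.τ_pos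
  obtain ⟨n, hn⟩ := exists_nat_ge (1 / (net.lamBar * net.τ))
  rw [div_le_iff₀' hl] at hn
  refine ENNReal.toReal_pos ?_ ((net.tsum_ite_le_one fun n => le_rfl).trans_lt ENNReal.one_lt_top).ne
  refine (lt_of_lt_of_le (net.usersProb_pos n) ?_).ne'
  refine le_trans ?_ (ENNReal.le_tsum n)
  rw [if_pos hn]

lemma activeProb_eq : net.activeProb = 1 - net.pFree + net.pFree * net.pFull := by
  unfold activeProb; ring

lemma activeProb_pos (hδ : net.hitRatio < 1) : 0 < net.activeProb := by
  unfold activeProb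
  have := mul_nonneg (sub_nonneg.2 net.pFull_le_one) (sub_nonneg.2 net.pFree_le_one)
  linarith [net.pFull_pos hδ]

lemma activeProb_le_one : net.activeProb ≤ 1 := by
  unfold activeProb
  have := mul_nonneg (sub_nonneg.2 net.pFull_le_one) net.pFree_nonneg
  linarith

lemma uncachedProb_eq : net.uncachedProb = (1 - net.hitRatio) / (1 - net.α * net.hitRatio) := by
  unfold uncachedProb; congr 1; ring

lemma uncachedProb_pos (hδ : net.hitRatio < 1) : 0 < net.uncachedProb := by
  rw [uncachedProb_eq]
  exact div_pos (sub_pos.2 hδ) (sub_pos.2 (net.mul_hitRatio_lt_one hδ))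

lemma uncachedProb_lt_one (hδ : net.hitRatio < 1) : net.uncachedProb < 1 := by
  rw [uncachedProb_eq, div_lt_one (sub_pos.2 (net.mul_hitRatio_lt_one hδ))]
  nlinarith [net.hitRatio_pos, net.α_lt_one]

end CacheNetwork

lemma coinLaw_true (p : ℝ) : coinLaw p {true} = ENNReal.ofReal p := by
  simp [coinLaw]

lemma isProbabilityMeasure_coinLaw {p : ℝ} (hp0 : 0 ≤ p) (hp1 : p ≤ 1) :
    IsProbabilityMeasure (coinLaw p) := ⟨by
  simp only [coinLaw, Measure.coe_add, Measure.coe_smul, Pi.add_apply, Pi.smul_apply,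
    measure_univ, smul_eq_mul, mul_one]
  rw [← ENNReal.ofReal_add hp0 (by linarith), add_sub_cancel, ENNReal.ofReal_one]⟩

/-! ### The nearest point of a sequence -/

/-- Index of the first point of smallest norm. -/
noncomputable def nearestIndex {E : Type*} [Norm E] (x : ℕ → E) : ℕ :=
  sInf {k | ∀ j, ‖x k‖ ≤ ‖x j‖}

lemma norm_nearestIndex_le {E : Type*} [Norm E] {x : ℕ → E} (h : ∃ k, ∀ j, ‖x k‖ ≤ ‖x j‖) (j : ℕ) :
    ‖x (nearestIndex x)‖ ≤ ‖x j‖ :=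
  Nat.sInf_mem (s := {k | ∀ j, ‖x k‖ ≤ ‖x j‖}) h j

open Classical in
-- The second alternative makes the predicate satisfiable for every sequence. When no minimum
-- exists, the search returns 0, which matches `sInf ∅ = 0`. Measurability of the index then follows
-- from that of a first-success search.
lemma nearestIndex_eq_find {E : Type*} [Norm E] {x : ℕ → E}
    (hex : ∃ k, (∀ j, ‖x k‖ ≤ ‖x j‖) ∨ ∀ k, ¬ ∀ j, ‖x k‖ ≤ ‖x j‖) :
    Nat.find hex = nearestIndex x := by
  by_cases h : ∃ k, ∀ j, ‖x k‖ ≤ ‖x j‖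
  · rw [nearestIndex, Nat.sInf_def (show Set.Nonempty {k | ∀ j, ‖x k‖ ≤ ‖x j‖} from h)]
    refine Nat.find_congr' fun {k} => ?_
    simp only [Set.mem_ofPred_eq, or_iff_left_iff_imp]
    exact fun hn => absurd h (not_exists.2 hn)
  · have h0 : {k | ∀ j, ‖x k‖ ≤ ‖x j‖} = ∅ := Set.eq_empty_of_forall_notMem (not_exists.1 h)
    rw [nearestIndex, h0, Nat.sInf_empty, Nat.find_eq_zero]
    exact Or.inr (not_exists.1 h)

/-- Evaluation of a sequence of measurable functions at a measurable random index. -/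
lemma measurable_apply_index {α β : Type*} [MeasurableSpace α] [MeasurableSpace β] {f : ℕ → α → β}
    (hf : ∀ k, Measurable (f k)) {i : α → ℕ} (hi : Measurable i) : Measurable fun a => f (i a) a := by
  have h : Measurable fun p : ℕ × α => f p.1 p.2 := measurable_from_prod_countable_right hf
  exact h.comp (hi.prodMk measurable_id)

lemma measurable_nearestIndex {E : Type*} [NormedAddCommGroup E] [MeasurableSpace E]
    [OpensMeasurableSpace E] : Measurable (nearestIndex : (ℕ → E) → ℕ) := by
  classical
  have hD : ∀ k, MeasurableSet {x : ℕ → E | ∀ j, ‖x k‖ ≤ ‖x j‖} := fun k => by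
    rw [Set.ofPred_forall]
    exact MeasurableSet.iInter fun j =>
      measurableSet_le (measurable_pi_apply k).norm (measurable_pi_apply j).norm
  have hN : MeasurableSet {x : ℕ → E | ∀ k, ¬ ∀ j, ‖x k‖ ≤ ‖x j‖} := by
    rw [Set.ofPred_forall]
    exact MeasurableSet.iInter fun k => (hD k).compl
  have hex : ∀ x : ℕ → E, ∃ k, (∀ j, ‖x k‖ ≤ ‖x j‖) ∨ ∀ k, ¬ ∀ j, ‖x k‖ ≤ ‖x j‖ := by
    intro x
    by_cases h : ∃ k, ∀ j, ‖x k‖ ≤ ‖x j‖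
    · exact ⟨h.choose, Or.inl h.choose_spec⟩
    · exact ⟨0, Or.inr (not_exists.1 h)⟩
  have hm : Measurable fun x => Nat.find (hex x) :=
    measurable_find hex fun k => (hD k).union hN
  have heq : (nearestIndex : (ℕ → E) → ℕ) = fun x => Nat.find (hex x) := by
    ext x
    symm
    exact nearestIndex_eq_find (hex x)
  rw [heq]
  exact hm

/-! ### Success probability in the downlink -/

/-- `𝔼 [exp (-(κ R²)) exp (-(a R))]` for a standard exponential variable `R`. -/
noncomputable def coverage (κ a : ℝ) : ℝ≥0∞ :=
  ∫⁻ r, expNeg (ENNReal.ofReal (κ * r ^ 2)) * expNeg (ENNReal.ofReal r * ENNReal.ofReal a)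
    ∂(expMeasure 1)

namespace DownlinkModel

variable {net : CacheNetwork} {Ω : Type*} [MeasurableSpace Ω] {μ : Measure Ω}
  (D : DownlinkModel net μ)

open Classical in
/-- Interference of the stations, farther away than the serving one, whose pair of flags
`(active, uncached)` belongs to `A`. -/
noncomputable def interference (A : Set (Bool × Bool)) (β : ℝ) (ω : Ω) : ℝ≥0∞ :=
  ∑' k, if ‖D.pos (D.serving ω) ω‖ < ‖D.pos k ω‖ ∧ (D.active k ω, D.uncached k ω) ∈ A
    then D.received β k ω else 0

lemma interferenceUntenable_eq (β : ℝ) (ω : Ω) :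
    D.interferenceUntenable β ω = D.interference {b | b.1 = true} β ω := by
  unfold interferenceUntenable interference
  congr!

lemma interferenceCached_eq (β : ℝ) (ω : Ω) :
    D.interferenceCached β ω = D.interference {b | b.1 = true ∧ b.2 = true} β ω := by
  unfold interferenceCached interference
  congr!

/-- The rescaled squared distances form a unit rate Poisson process on the half-line. -/
lemma isPoissonPointProcess_normSq :
    IsPoissonPointProcess (fun k ω => Real.pi * net.φb * ‖D.pos k ω‖ ^ 2)
      (volume.restrict (Set.Ioi 0)) μ := by
  rw [← map_normSq_volume_eq net.φb_pos]
  exact D.poisson.map (π := fun x => Real.pi * net.φb * ‖x‖ ^ 2) (by fun_prop)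

lemma measurable_pos : Measurable fun ω k => D.pos k ω :=
  measurable_pi_lambda _ fun k => D.poisson.measurable k

lemma ae_norm_serving_le : ∀ᵐ ω ∂μ, ∀ j, ‖D.pos (D.serving ω) ω‖ ≤ ‖D.pos j ω‖ := by
  have hc : 0 < Real.pi * net.φb := mul_pos Real.pi_pos net.φb_pos
  filter_upwards [D.isPoissonPointProcess_normSq.ae_exists_le] with ω ⟨k, hk⟩
  refine norm_nearestIndex_le (x := fun k => D.pos k ω) ⟨k, fun j => ?_⟩
  have := le_of_mul_le_mul_left (hk j) hc
  exact (pow_le_pow_iff_left₀ (norm_nonneg _) (norm_nonneg _) two_ne_zero).1 this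

lemma ae_norm_pos : ∀ᵐ ω ∂μ, ∀ k, 0 < ‖D.pos k ω‖ := by
  filter_upwards [D.isPoissonPointProcess_normSq.ae_forall_pos] with ω hω k
  refine (norm_nonneg _).lt_of_ne fun h => ?_
  have := hω k
  rw [← h] at this
  simp at this

lemma measurable_mark (k : ℕ) :
    Measurable fun ω => (D.fading k ω, D.active k ω, D.uncached k ω) :=
  (D.measurable_fading k).prodMk ((D.measurable_active k).prodMk (D.measurable_uncached k))

lemma measurable_norm_serving : Measurable fun ω => ‖D.pos (D.serving ω) ω‖ := by
  exact measurable_apply_index (f := fun k ω => ‖D.pos k ω‖) (fun k => (D.poisson.measurable k).norm)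
    (measurable_nearestIndex.comp D.measurable_pos)

open Classical in
/-- The event that the signal of the nearest station is strong enough, as a set of positions and
marks. The parameter `y` stands for the noise. -/
def successSet (A : Set (Bool × Bool)) (θ y : ℝ) :
    Set ((ℕ → EuclideanSpace ℝ (Fin 2)) × (ℕ → ℝ × Bool × Bool)) :=
  {q | ENNReal.ofReal (y * ‖q.1 (nearestIndex q.1)‖ ^ 4)
      + ∑' k, (if ‖q.1 (nearestIndex q.1)‖ < ‖q.1 k‖ ∧ (q.2 k).2 ∈ A then
          ENNReal.ofReal (θ * (‖q.1 (nearestIndex q.1)‖ / ‖q.1 k‖) ^ 4 * (q.2 k).1) else 0)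
      ≤ ENNReal.ofReal (q.2 (nearestIndex q.1)).1}

lemma measurableSet_successSet (A : Set (Bool × Bool)) (θ y : ℝ) :
    MeasurableSet (successSet A θ y) := by
  classical
  have hi : Measurable fun q : (ℕ → EuclideanSpace ℝ (Fin 2)) × (ℕ → ℝ × Bool × Bool) =>
      nearestIndex q.1 := measurable_nearestIndex.comp measurable_fst
  have h3 : ∀ k, Measurable fun q : (ℕ → EuclideanSpace ℝ (Fin 2)) × (ℕ → ℝ × Bool × Bool) =>
      ‖q.1 k‖ := fun k => ((measurable_pi_apply k).comp measurable_fst).norm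
  have h4 : ∀ k, Measurable fun q : (ℕ → EuclideanSpace ℝ (Fin 2)) × (ℕ → ℝ × Bool × Bool) =>
      q.2 k := fun k => (measurable_pi_apply k).comp measurable_snd
  have h1 := measurable_apply_index h3 hi
  have h2 := measurable_apply_index (fun k => (h4 k).fst) hi
  refine measurableSet_le (Measurable.add ((h1.pow_const 4).const_mul y).ennreal_ofReal
    (Measurable.tsum fun k => Measurable.ite ?_ ?_ measurable_const)) h2.ennreal_ofReal
  · exact (measurableSet_lt h1 (h3 k)).inter ((h4 k).snd (MeasurableSet.of_discrete (s := A)))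
  · exact ((((h1.div (h3 k)).pow_const 4).const_mul θ).mul (h4 k).fst).ennreal_ofReal

lemma ae_le_sinr_iff (A : Set (Bool × Bool)) {θ σ2 : ℝ} (hθ : 0 < θ) (hσ : 0 < σ2) :
    ∀ᵐ ω ∂μ, (ENNReal.ofReal θ ≤ D.received 4 (D.serving ω) ω
        / (D.interference A 4 ω + ENNReal.ofReal σ2)) ↔
      ((fun k => D.pos k ω), fun k => (D.fading k ω, D.active k ω, D.uncached k ω))
        ∈ successSet A θ (θ * σ2 / net.P) := by
  classical
  filter_upwards [D.ae_norm_pos] with ω hω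
  have hP := net.P_pos
  set i := D.serving ω with hi
  set r := ‖D.pos i ω‖ with hr
  have hr0 : 0 < r := hω i
  have hrec : ∀ k, D.received 4 k ω
      = ENNReal.ofReal (net.P / ‖D.pos k ω‖ ^ 4) * ENNReal.ofReal (D.fading k ω) := by
    intro k
    have hk := hω k
    rw [received, ← ENNReal.ofReal_mul (by positivity), Real.rpow_neg hk.le]
    congr 1
    norm_num
    field_simp
  have hc : 0 < net.P / r ^ 4 := by positivity
  have hsucc : ((fun k => D.pos k ω), fun k => (D.fading k ω, D.active k ω, D.uncached k ω))
        ∈ successSet A θ (θ * σ2 / net.P) ↔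
      ENNReal.ofReal (θ * σ2 / net.P * r ^ 4)
      + ∑' k, (if r < ‖D.pos k ω‖ ∧ (D.active k ω, D.uncached k ω) ∈ A then
          ENNReal.ofReal (θ * (r / ‖D.pos k ω‖) ^ 4 * D.fading k ω) else 0)
      ≤ ENNReal.ofReal (D.fading i ω) := Iff.rfl
  -- The SINR inequality is the success inequality multiplied by P r⁻⁴, a finite nonzero factor;
  -- this explains the noise parameter θσ²/P and the ratios (r/d_k)⁴.
  have hmul : ENNReal.ofReal (net.P / r ^ 4) * (ENNReal.ofReal (θ * σ2 / net.P * r ^ 4)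
      + ∑' k, (if r < ‖D.pos k ω‖ ∧ (D.active k ω, D.uncached k ω) ∈ A then
          ENNReal.ofReal (θ * (r / ‖D.pos k ω‖) ^ 4 * D.fading k ω) else 0))
      = ENNReal.ofReal θ * (D.interference A 4 ω + ENNReal.ofReal σ2) := by
    rw [mul_add, mul_add, add_comm, interference, ← ENNReal.tsum_mul_left, ← ENNReal.tsum_mul_left,
      ← ENNReal.ofReal_mul hc.le, ← ENNReal.ofReal_mul hθ.le]
    congr 1
    · refine tsum_congr fun k => ?_
      have hk := hω k
      simp only [mul_ite, mul_zero]
      refine if_congr Iff.rfl ?_ rfl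
      rw [hrec, ← mul_assoc, ← ENNReal.ofReal_mul hθ.le, ← ENNReal.ofReal_mul hc.le,
        ← ENNReal.ofReal_mul (by positivity)]
      congr 1
      field_simp
    · congr 1
      field_simp
  rw [hsucc, hrec, ENNReal.le_div_iff_mul_le (Or.inl (by simp [hσ]))
    (Or.inr (ENNReal.mul_ne_top ENNReal.ofReal_ne_top ENNReal.ofReal_ne_top)), ← hmul]
  exact ENNReal.mul_le_mul_iff_right (by simpa using hc) ENNReal.ofReal_ne_top

/-- Success probability, for the path-loss exponent `4`. -/
theorem measure_le_sinr [IsProbabilityMeasure μ] (hδ : net.hitRatio < 1) (A : Set (Bool × Bool))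
    {p : ℝ} (hp0 : 0 ≤ p) (hp1 : p ≤ 1)
    (hpA : ((coinLaw net.activeProb).prod (coinLaw net.uncachedProb)) A = ENNReal.ofReal p)
    {θ σ2 : ℝ} (hθ : 0 < θ) (hσ : 0 < σ2) :
    μ {ω | ENNReal.ofReal θ ≤ D.received 4 (D.serving ω) ω
        / (D.interference A 4 ω + ENNReal.ofReal σ2)}
      = coverage (θ * σ2 / net.P / (Real.pi * net.φb) ^ 2)
          (p * (Real.sqrt θ * Real.arctan (Real.sqrt θ))) := by
  classical
  have hc : 0 < Real.pi * net.φb := mul_pos Real.pi_pos net.φb_pos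
  have hP := net.P_pos
  have hφ := net.φb_pos
  have := isProbabilityMeasure_coinLaw (net.activeProb_pos hδ).le net.activeProb_le_one
  have := isProbabilityMeasure_coinLaw (net.uncachedProb_pos hδ).le (net.uncachedProb_lt_one hδ).le
  have hexp := isProbabilityMeasure_expMeasure one_pos
  set y := θ * σ2 / net.P with hy
  have hy0 : 0 < y := by positivity
  have hmarks : Measurable fun ω k => (D.fading k ω, D.active k ω, D.uncached k ω) :=
    measurable_pi_lambda _ D.measurable_mark
  have e1 : μ {ω | ENNReal.ofReal θ ≤ D.received 4 (D.serving ω) ω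
        / (D.interference A 4 ω + ENNReal.ofReal σ2)}
      = μ {ω | ((fun k => D.pos k ω), fun k => (D.fading k ω, D.active k ω, D.uncached k ω))
        ∈ successSet A θ y} :=
    measure_congr ((D.ae_le_sinr_iff A hθ hσ).mono fun ω h => propext h)
  -- Condition on the positions: only the marks remain random in the inner probability.
  rw [e1, D.pos_mark_indep.measure_prodMk_mem D.measurable_pos hmarks
    (measurableSet_successSet A θ y)]
  set R : Ω → ℝ := fun ω => Real.pi * net.φb * ‖D.pos (D.serving ω) ω‖ ^ 2 with hR
  set Y : ℕ → Ω → ℝ := fun k ω => Real.pi * net.φb * ‖D.pos k ω‖ ^ 2 with hY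
  have hRm : Measurable R := (D.measurable_norm_serving.pow_const 2).const_mul _
  have hleast : ∀ᵐ ω ∂μ, IsLeast (Set.range fun k => Y k ω) (R ω) := by
    filter_upwards [D.ae_norm_serving_le] with ω hω
    refine ⟨⟨D.serving ω, rfl⟩, ?_⟩
    rintro _ ⟨k, rfl⟩
    simp only [hR, hY]
    gcongr
    exact hω k
  -- The noise factor exp(-y r⁴) as a function of R = πφ_b r².
  have hw : Continuous fun r : ℝ =>
      expNeg (ENNReal.ofReal (y / (Real.pi * net.φb) ^ 2 * r ^ 2)) :=
    continuous_expNeg.comp (ENNReal.continuous_ofReal.comp (by fun_prop))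
  have hmain := D.isPoissonPointProcess_normSq.lintegral_isLeast_expNeg_tsum hRm hleast hw
    (fun r => expNeg_le_one _) measurable_attenuation (continuousOn_attenuation hp1 hθ.le)
    fun u _ => attenuation_le hp1 hθ.le u
  rw [lintegral_one_sub_expNeg_attenuation hp0 hp1 hθ] at hmain
  rw [coverage, ← hmain]
  refine lintegral_congr_ae ?_
  filter_upwards [D.ae_norm_pos] with ω hω
  set i := D.serving ω with hi
  set r := ‖D.pos i ω‖ with hr
  have hr0 : 0 < r := hω i
  set J : ℕ → ℝ × Bool × Bool → ℝ≥0∞ := fun k m =>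
    if r < ‖D.pos k ω‖ ∧ m.2 ∈ A then ENNReal.ofReal (θ * (r / ‖D.pos k ω‖) ^ 4 * m.1) else 0 with hJ
  -- Here Y/R = (d_k/r)², so θ/u² in `attenuation` is θ(r/d_k)⁴, the coefficient of the fading in
  -- `J`.
  set c : ℕ → ℝ≥0∞ := fun k => if R ω < Y k ω then attenuation p θ (Y k ω / R ω) else 0 with hcdef
  have hlt : ∀ k, R ω < Y k ω ↔ r < ‖D.pos k ω‖ := by
    intro k
    simp only [hR, hY]
    rw [mul_lt_mul_iff_right₀ hc]
    exact pow_lt_pow_iff_left₀ (norm_nonneg _) (norm_nonneg _) two_ne_zero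
  have hJm : ∀ k, Measurable (J k) := fun k => by
    refine Measurable.ite ?_ (by fun_prop) measurable_const
    exact (MeasurableSet.const _).inter (measurable_snd (MeasurableSet.of_discrete (s := A)))
  have hJc : ∀ k, ∫⁻ x, expNeg (J k x) ∂((expMeasure 1).prod
      ((coinLaw net.activeProb).prod (coinLaw net.uncachedProb))) = expNeg (c k) := by
    intro k
    have hk := hω k
    simp only [hJ, hcdef, hlt]
    by_cases h : r < ‖D.pos k ω‖
    · simp only [h, true_and, if_true]
      rw [lintegral_expNeg_thinned (MeasurableSet.of_discrete) hp0 hp1 hpA (by positivity),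
        expNeg_attenuation hp0 hp1 hθ.le]
      congr 4
      simp only [hR, hY]
      rw [← hi, ← hr]
      field_simp
    · simp [h]
  have hJ0 : J i = 0 := by
    ext m
    simp [hJ, hr]
  have hHlaw : ((expMeasure 1).prod ((coinLaw net.activeProb).prod (coinLaw net.uncachedProb))).map
      Prod.fst = expMeasure 1 := by
    rw [Measure.map_fst_prod]; simp
  have hfinal := measure_add_tsum_le_ofReal D.measurable_mark D.mark_indep D.mark_law measurable_fst
    hHlaw hJm hJc i hJ0 (ENNReal.ofReal (y * r ^ 4))
  refine Eq.trans ?_ (hfinal.trans ?_)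
  · rfl
  · congr 3
    simp only [hR]
    rw [← hi, ← hr]
    field_simp

end DownlinkModel

/-! ### Vanishing noise limit and strict monotonicity of the coverage -/

lemma ae_expMeasure_pos : ∀ᵐ r ∂(expMeasure 1), 0 < r := by
  rw [ae_iff]
  simp only [not_lt]
  change (volume.withDensity _) (Set.Iic 0) = 0
  rw [withDensity_apply _ measurableSet_Iic, ← restrict_Iio_eq_restrict_Iic]
  exact lintegral_gammaPDF_of_nonpos le_rfl

lemma coverage_zero {a : ℝ} (ha : 0 ≤ a) : coverage 0 a = ENNReal.ofReal (1 / (1 + a)) := by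
  rw [← lintegral_expNeg_expMeasure ha, coverage]
  refine lintegral_congr fun r => ?_
  rw [mul_comm (ENNReal.ofReal r), ← ENNReal.ofReal_mul ha]
  simp

lemma coverage_le_one (κ a : ℝ) : coverage κ a ≤ 1 := by
  have := isProbabilityMeasure_expMeasure one_pos
  calc coverage κ a ≤ ∫⁻ _, 1 ∂(expMeasure 1) :=
        lintegral_mono fun r => mul_le_one' (expNeg_le_one _) (expNeg_le_one _)
    _ = 1 := by simp

lemma coverage_ne_top (κ a : ℝ) : coverage κ a ≠ ∞ :=
  ((coverage_le_one κ a).trans_lt ENNReal.one_lt_top).ne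

lemma tendsto_coverage {a : ℝ} (ha : 0 ≤ a) :
    Tendsto (fun κ => coverage κ a) (𝓝 0) (𝓝 (ENNReal.ofReal (1 / (1 + a)))) := by
  have := isProbabilityMeasure_expMeasure one_pos
  rw [← coverage_zero ha]
  refine tendsto_lintegral_filter_of_dominated_convergence (fun _ => 1)
    (Eventually.of_forall fun κ => by fun_prop)
    (Eventually.of_forall fun κ => ae_of_all _ fun r =>
      mul_le_one' (expNeg_le_one _) (expNeg_le_one _)) (by simp) (ae_of_all _ fun r => ?_)
  refine ENNReal.Tendsto.mul_const ?_ (Or.inr (expNeg_ne_top _))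
  exact (continuous_expNeg.comp (ENNReal.continuous_ofReal.comp
    (continuous_mul_const (r ^ 2)))).tendsto 0

/-- The integrands compare strictly at every r > 0, hence almost everywhere, and the smaller
integral is finite. -/
lemma coverage_lt {κ a b : ℝ} (hab : a < b) (hb : 0 < b) : coverage κ b < coverage κ a := by
  have := isProbabilityMeasure_expMeasure one_pos
  refine lintegral_strict_mono (NeZero.ne _) (by fun_prop) (coverage_ne_top κ b) ?_
  filter_upwards [ae_expMeasure_pos] with r hr
  have h0 : expNeg (ENNReal.ofReal (κ * r ^ 2)) ≠ 0 := by
    have := expNeg_strictAnti (ENNReal.ofReal_lt_top (r := κ * r ^ 2))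
    exact (zero_le.trans_lt this).ne'
  refine ENNReal.mul_lt_mul_right h0 (expNeg_ne_top _) (expNeg_strictAnti ?_)
  exact ENNReal.mul_lt_mul_right (by simpa using hr) ENNReal.ofReal_ne_top
    ((ENNReal.ofReal_lt_ofReal_iff hb).2 hab)

lemma one_sub_one_div_one_add {a : ℝ} (ha : 0 < a) : 1 - 1 / (1 + a) = 1 / (a⁻¹ + 1) := by
  field_simp
  ring

/-! ### Loss rates in terms of the coverage -/

namespace DownlinkModel

variable {net : CacheNetwork} {Ω : Type*} [MeasurableSpace Ω] {μ : Measure Ω}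
  (D : DownlinkModel net μ)

lemma measureReal_loss [IsProbabilityMeasure μ] (hδ : net.hitRatio < 1) (A : Set (Bool × Bool))
    {p : ℝ} (hp0 : 0 ≤ p) (hp1 : p ≤ 1)
    (hpA : ((coinLaw net.activeProb).prod (coinLaw net.uncachedProb)) A = ENNReal.ofReal p)
    {σ2 : ℝ} (hσ : 0 < σ2) :
    μ.real {ω | net.τ * net.B * Real.logb 2 (1 + (D.received 4 (D.serving ω) ω
        / (D.interference A 4 ω + ENNReal.ofReal σ2)).toReal) < net.T}
      = 1 - (coverage (net.Tbar * σ2 / net.P / (Real.pi * net.φb) ^ 2)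
          (p * (Real.sqrt net.Tbar * Real.arctan (Real.sqrt net.Tbar)))).toReal := by
  have hτB : 0 < net.τ * net.B := mul_pos net.τ_pos net.B_pos
  rw [← D.measure_le_sinr hδ A hp0 hp1 hpA net.Tbar_pos hσ]
  set S := {ω | ENNReal.ofReal net.Tbar ≤ D.received 4 (D.serving ω) ω
        / (D.interference A 4 ω + ENNReal.ofReal σ2)} with hS
  -- The success event agrees with a measurable set only almost surely, which is enough to take
  -- complements.
  have hSm : NullMeasurableSet S μ := by
    have hm : MeasurableSet ((fun ω => ((fun k => D.pos k ω),
        fun k => (D.fading k ω, D.active k ω, D.uncached k ω))) ⁻¹'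
          successSet A net.Tbar (net.Tbar * σ2 / net.P)) :=
      (D.measurable_pos.prodMk (measurable_pi_lambda _ D.measurable_mark))
        (measurableSet_successSet A _ _)
    exact hm.nullMeasurableSet.congr
      ((D.ae_le_sinr_iff A net.Tbar_pos hσ).mono fun ω h => propext h.symm)
  have hcompl : {ω | net.τ * net.B * Real.logb 2 (1 + (D.received 4 (D.serving ω) ω
        / (D.interference A 4 ω + ENNReal.ofReal σ2)).toReal) < net.T} = Sᶜ := by
    ext ω
    set x := D.received 4 (D.serving ω) ω / (D.interference A 4 ω + ENNReal.ofReal σ2) with hx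
    -- Positive noise keeps the SINR finite, so `toReal` loses nothing.
    have hxt : x ≠ ∞ := ENNReal.div_ne_top ENNReal.ofReal_ne_top (by simp [hσ])
    have hx0 : (0 : ℝ) < 1 + x.toReal := by positivity
    change net.τ * net.B * Real.logb 2 (1 + x.toReal) < net.T ↔ ¬ ENNReal.ofReal net.Tbar ≤ x
    rw [ENNReal.ofReal_le_iff_le_toReal hxt, not_le, ← lt_div_iff₀' hτB,
      Real.logb_lt_iff_lt_rpow one_lt_two hx0, CacheNetwork.Tbar, lt_sub_iff_add_lt']
  rw [hcompl, measureReal_def, prob_compl_eq_one_sub₀ hSm,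
    ENNReal.toReal_sub_of_le prob_le_one ENNReal.one_ne_top, ENNReal.toReal_one]

lemma lossUntenable_eq [IsProbabilityMeasure μ] (hδ : net.hitRatio < 1) {σ2 : ℝ} (hσ : 0 < σ2) :
    D.lossUntenable 4 σ2 = 1 - (coverage (net.Tbar * σ2 / net.P / (Real.pi * net.φb) ^ 2)
      (net.activeProb * (Real.sqrt net.Tbar * Real.arctan (Real.sqrt net.Tbar)))).toReal := by
  have := isProbabilityMeasure_coinLaw (net.activeProb_pos hδ).le net.activeProb_le_one
  have := isProbabilityMeasure_coinLaw (net.uncachedProb_pos hδ).le (net.uncachedProb_lt_one hδ).le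
  rw [← D.measureReal_loss hδ {b | b.1 = true} (net.activeProb_pos hδ).le net.activeProb_le_one ?_ hσ]
  · simp_rw [← interferenceUntenable_eq]
    rfl
  · have hA : {b : Bool × Bool | b.1 = true} = {true} ×ˢ Set.univ := by ext; simp
    rw [hA, Measure.prod_prod, coinLaw_true, measure_univ, mul_one]

lemma lossCached_eq [IsProbabilityMeasure μ] (hδ : net.hitRatio < 1) {σ2 : ℝ} (hσ : 0 < σ2) :
    D.lossCached 4 σ2 = 1 - (coverage (net.Tbar * σ2 / net.P / (Real.pi * net.φb) ^ 2)
      (net.activeProb * net.uncachedProb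
        * (Real.sqrt net.Tbar * Real.arctan (Real.sqrt net.Tbar)))).toReal := by
  have h1 := net.activeProb_pos hδ
  have h2 := net.uncachedProb_pos hδ
  have := isProbabilityMeasure_coinLaw h1.le net.activeProb_le_one
  have := isProbabilityMeasure_coinLaw h2.le (net.uncachedProb_lt_one hδ).le
  rw [← D.measureReal_loss hδ {b | b.1 = true ∧ b.2 = true} (mul_pos h1 h2).le
    (mul_le_one₀ net.activeProb_le_one h2.le (net.uncachedProb_lt_one hδ).le) ?_ hσ]
  · simp_rw [← interferenceCached_eq]
    rfl
  · have hA : {b : Bool × Bool | b.1 = true ∧ b.2 = true} = {true} ×ˢ {true} := rfl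
    rw [hA, Measure.prod_prod, coinLaw_true, coinLaw_true, ENNReal.ofReal_mul h1.le]

end DownlinkModel

lemma tendsto_one_sub_coverage {a : ℝ} (ha : 0 < a) {κ : ℝ → ℝ} (hκ : Tendsto κ (𝓝[>] 0) (𝓝 0)) :
    Tendsto (fun σ2 => 1 - (coverage (κ σ2) a).toReal) (𝓝[>] 0) (𝓝 (1 / (a⁻¹ + 1))) := by
  have h := (ENNReal.tendsto_toReal ENNReal.ofReal_ne_top).comp ((tendsto_coverage ha.le).comp hκ)
  rw [ENNReal.toReal_ofReal (by positivity)] at h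
  rw [← one_sub_one_div_one_add ha]
  exact tendsto_const_nhds.sub h

theorem corollary2 (net : CacheNetwork) (hδ : net.hitRatio < 1)
    {Ω : Type*} [MeasurableSpace Ω] (μ : Measure Ω) [IsProbabilityMeasure μ]
    (D : DownlinkModel net μ) :
    Tendsto (fun σ2 : ℝ => D.lossCached 4 σ2) (𝓝[>] 0)
      (𝓝 (1 / (((1 - net.pFree + net.pFree * net.pFull) * (1 - net.hitRatio)
        / (1 - net.α * net.hitRatio)
        * (Real.sqrt net.Tbar * Real.arctan (Real.sqrt net.Tbar)))⁻¹ + 1))) ∧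
    Tendsto (fun σ2 : ℝ => D.lossUntenable 4 σ2) (𝓝[>] 0)
      (𝓝 (1 / (((1 - net.pFree + net.pFree * net.pFull)
        * (Real.sqrt net.Tbar * Real.arctan (Real.sqrt net.Tbar)))⁻¹ + 1))) ∧
    1 / (((1 - net.pFree + net.pFree * net.pFull) * (1 - net.hitRatio)
        / (1 - net.α * net.hitRatio)
        * (Real.sqrt net.Tbar * Real.arctan (Real.sqrt net.Tbar)))⁻¹ + 1)
      < 1 / (((1 - net.pFree + net.pFree * net.pFull)
        * (Real.sqrt net.Tbar * Real.arctan (Real.sqrt net.Tbar)))⁻¹ + 1) ∧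
    ∀ σ2 : ℝ, 0 < σ2 → D.lossCached 4 σ2 < D.lossUntenable 4 σ2 := by
  have hp := net.activeProb_pos hδ
  have hq := net.uncachedProb_pos hδ
  have hq1 := net.uncachedProb_lt_one hδ
  have hs : 0 < Real.sqrt net.Tbar := Real.sqrt_pos.2 net.Tbar_pos
  have hA : 0 < Real.sqrt net.Tbar * Real.arctan (Real.sqrt net.Tbar) :=
    mul_pos hs (Real.arctan_pos.2 hs)
  rw [mul_div_assoc, ← net.activeProb_eq, ← net.uncachedProb_eq]
  set A := Real.sqrt net.Tbar * Real.arctan (Real.sqrt net.Tbar) with hAdef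
  -- Both strict comparisons come from this inequality alone: cancelling cached packets thins the
  -- interferers by a factor below 1.
  have hlt : net.activeProb * net.uncachedProb * A < net.activeProb * A := by
    gcongr
    exact mul_lt_of_lt_one_right hp hq1
  have hκ : Tendsto (fun σ2 => net.Tbar * σ2 / net.P / (Real.pi * net.φb) ^ 2) (𝓝[>] 0) (𝓝 0) := by
    have hc : Continuous fun σ2 : ℝ => net.Tbar * σ2 / net.P / (Real.pi * net.φb) ^ 2 := by fun_prop
    exact (hc.tendsto' 0 0 (by simp)).mono_left nhdsWithin_le_nhds
  refine ⟨?_, ?_, ?_, fun σ2 hσ => ?_⟩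
  · refine (tendsto_one_sub_coverage (by positivity) hκ).congr' ?_
    filter_upwards [self_mem_nhdsWithin] with σ2 hσ using (D.lossCached_eq hδ hσ).symm
  · refine (tendsto_one_sub_coverage (by positivity) hκ).congr' ?_
    filter_upwards [self_mem_nhdsWithin] with σ2 hσ using (D.lossUntenable_eq hδ hσ).symm
  · gcongr
  · rw [D.lossCached_eq hδ hσ, D.lossUntenable_eq hδ hσ]
    refine sub_lt_sub_left ((ENNReal.toReal_lt_toReal (coverage_ne_top _ _)
      (coverage_ne_top _ _)).2 (coverage_lt hlt (by positivity))) 1
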